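/- Let $k>0$ and $d\in\{2,3\}$. Put $c_2=k^{3/2}$, $c_3=k^2$, and let $G$ be the outgoing Green's function $$G(r,r')=\tfrac{i}{4}H_0^{(1)}(k|r-r'|)\quad(d=2),\qquad G(r,r')=\frac{e^{ik|r-r'|}}{4\pi|r-r'|}\quad(d=3),$$ where $H_0^{(1)}=J_0+iY_0$ is the Hankel function of the first kind of order zero. Let $\Omega\subset\mathbb R^d$ be a bounded measurable set (the scatterer) and let $\eta:\mathbb R^d\to\mathbb C$ (the susceptibility) be integrable and zero outside $\Omega$. Fix a detector position $r_2\neq 0$ and put $\hat r_2=r_2/|r_2|$. For a point source of unit amplitude at $r_1$, the weak-scattering (Born) scattering amplitude is $$A(r_1,r_2)=c_d\int_\Omega e^{-ik\hat r_2\cdot r}\,\eta(r)\,G(r,r_1)\,dr .$$ 1. The integral converges absolutely for almost every $r_1\in\mathbb R^d$, the function $A(\cdot,r_2)$ is locally integrable, and in the sense of distributions on $\mathbb R^d$ $$(\Delta_{r_1}+k^2)A(r_1,r_2)=-c_d\,e^{-ik\hat r_2\cdot r_1}\,\eta(r_1).$$ 2. Consequently $\eta$ is recovered almost everywhere from $A(\cdot,r_2)$: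 if $g$ is any locally integrable function with $(\Delta_{r_1}+k^2)A(\cdot,r_2)=g$ in the sense of distributions, then $\eta(r_1)=-\dfrac{e^{ik\hat r_2\cdot r_1}}{c_d}\,g(r_1)$ for almost every $r_1$. 3. At every point $r_1\in\mathbb R^d$ such that $\eta$ is Hölder continuous (with some positive exponent) in a neighbourhood of $r_1$, the integral converges absolutely, $A(\cdot,r_2)$ is twice continuously differentiable near $r_1$, and, with the classical Laplacian, $$\Delta_{r_1}A(r_1,r_2)+k^2A(r_1,r_2)=-c_d\,e^{-ik\hat r_2\cdot r_1}\,\eta(r_1),$$ so that $$\eta(r_1)=-\frac{e^{ik\hat r_2\cdot r_1}}{c_d}\bigl(\Delta_{r_1}A(r_1,r_2)+k^2A(r_1,r_2)\bigr).$$ -/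

import Mathlib

open MeasureTheory Topology
open scoped ContDiff NNReal RealInnerProductSpace Laplacian

noncomputable section

namespace InverseScattering

/-- The Bessel function of the first kind of order zero,
`J₀(x) = ∑ₘ (-1)ᵐ (x/2)²ᵐ / (m!)²`. -/
def besselJ0 (x : ℝ) : ℝ :=
  ∑' m : ℕ, (-1) ^ m * (x / 2) ^ (2 * m) / (m.factorial : ℝ) ^ 2

/-- The Bessel function of the second kind of order zero, for `x > 0`:
`Y₀(x) = (2/π) ((log (x/2) + γ) J₀(x) - ∑ₘ (-1)ᵐ Hₘ (x/2)²ᵐ / (m!)²)`,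
where `Hₘ = 1 + 1/2 + ⋯ + 1/m` and `γ` is the Euler-Mascheroni constant. -/
def besselY0 (x : ℝ) : ℝ :=
  2 / Real.pi * ((Real.log (x / 2) + Real.eulerMascheroniConstant) * besselJ0 x -
    ∑' m : ℕ, (-1) ^ m * ((harmonic m : ℚ) : ℝ) * (x / 2) ^ (2 * m) / (m.factorial : ℝ) ^ 2)

/-- The Hankel function of the first kind of order zero, `H₀⁽¹⁾(x) = J₀(x) + i Y₀(x)`, `x > 0`. -/
def hankelH0 (x : ℝ) : ℂ := (besselJ0 x : ℂ) + Complex.I * (besselY0 x : ℂ)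

/-- The two-dimensional Green's function `G(r, r') = (i/4) H₀⁽¹⁾(k |r - r'|)`. -/
def green2D (k : ℝ) (r r' : EuclideanSpace ℝ (Fin 2)) : ℂ :=
  Complex.I / 4 * hankelH0 (k * ‖r - r'‖)

/-- The three-dimensional Green's function `G(r, r') = exp(i k |r - r'|) / (4 π |r - r'|)`. -/
def green3D (k : ℝ) (r r' : EuclideanSpace ℝ (Fin 3)) : ℂ :=
  Complex.exp (Complex.I * ((k * ‖r - r'‖ : ℝ) : ℂ)) / ((4 * Real.pi * ‖r - r'‖ : ℝ) : ℂ)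

/-- The phase factor `exp(i k r̂₂ · r)` with `r̂₂ = r₂ / |r₂|`. -/
def phase {d : ℕ} (k : ℝ) (r₂ r : EuclideanSpace ℝ (Fin d)) : ℂ :=
  Complex.exp (Complex.I * ((k * ⟪‖r₂‖⁻¹ • r₂, r⟫ : ℝ) : ℂ))

/-- The integrand `exp(-i k r̂₂ · r) η(r) U(r)` of the scattering amplitude
of the field `U`. -/
def amplitudeIntegrand {d : ℕ} (k : ℝ) (η U : EuclideanSpace ℝ (Fin d) → ℂ)
    (r₂ r : EuclideanSpace ℝ (Fin d)) : ℂ :=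
  (phase k r₂ r)⁻¹ * η r * U r

/-- The two-dimensional scattering amplitude in the weak-scattering approximation, for a
unit-amplitude point source at `r₁` (incident field `r ↦ G(r, r₁)`) and a detector at `r₂`:
`A(r₁, r₂) = k^{3/2} ∫_Ω exp(-i k r̂₂ · r) η(r) G(r, r₁) dr`. -/
def amplitude2D (k : ℝ) (Ω : Set (EuclideanSpace ℝ (Fin 2))) (η : EuclideanSpace ℝ (Fin 2) → ℂ)
    (r₁ r₂ : EuclideanSpace ℝ (Fin 2)) : ℂ :=
  ((k ^ (3 / 2 : ℝ) : ℝ) : ℂ) *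
    ∫ r in Ω, amplitudeIntegrand k η (fun r => green2D k r r₁) r₂ r

/-- The three-dimensional scattering amplitude in the weak-scattering approximation:
`A(r₁, r₂) = k² ∫_Ω exp(-i k r̂₂ · r) η(r) G(r, r₁) dr`. -/
def amplitude3D (k : ℝ) (Ω : Set (EuclideanSpace ℝ (Fin 3))) (η : EuclideanSpace ℝ (Fin 3) → ℂ)
    (r₁ r₂ : EuclideanSpace ℝ (Fin 3)) : ℂ :=
  ((k ^ 2 : ℝ) : ℂ) *
    ∫ r in Ω, amplitudeIntegrand k η (fun r => green3D k r r₁) r₂ r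

/-- `Δ u + k² u = f` in the sense of distributions on `ℝᵈ`, for locally integrable functions
`u` and `f`. -/
def HelmholtzDistrib {d : ℕ} (k : ℝ) (u f : EuclideanSpace ℝ (Fin d) → ℂ) : Prop :=
  LocallyIntegrable u ∧ LocallyIntegrable f ∧
    ∀ φ : EuclideanSpace ℝ (Fin d) → ℂ, ContDiff ℝ ∞ φ → HasCompactSupport φ →
      ∫ x, u x * (Δ φ x + (k : ℂ) ^ 2 * φ x) = ∫ x, f x * φ x

/-- `η` is Hölder continuous, with some positive exponent, in some neighbourhood of `r`. -/
def HolderNear {d : ℕ} (η : EuclideanSpace ℝ (Fin d) → ℂ) (r : EuclideanSpace ℝ (Fin d)) : Prop :=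
  ∃ s ∈ 𝓝 r, ∃ C α : ℝ≥0, 0 < α ∧ HolderOnWith C α η s

end InverseScattering

end

noncomputable section

open Filter Set

namespace InverseScattering

/-! With the density f(r) = c e^{-ik r̂₂·r} η(r), which is integrable with bounded support, the
amplitude is the volume potential ∫ f(y) h(|r₁ - y|²) dy, where h is the Green's function written in
the squared distance t. The phase has modulus one and c ≠ 0, so η is read off from f.
`HelmholtzProfile` records all that is needed of h: the radial equation 4t h'' + 2d h' + k² h = 0
and the behaviour at t = 0. `HelmholtzProfile.inversion` then treats all dimensions at once; the
explicit Green's functions enter only through `helmholtzProfile_profile2D` and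
`helmholtzProfile_profile3D`.

That h(|z|²) is a fundamental solution (`integral_radial_mul_helmholtz`) is shown without surface
integrals. The shifted kernel h(|z|² + ε²) is C² on the whole space, and by the radial equation Δ +
k² maps it to -4ε² h''(|z|² + ε²). After z = εw this is an approximate identity of mass -1. Fubini
with translated test functions gives the distributional equation for the potential
(`helmholtzDistrib_potential`), and the fundamental lemma of the calculus of variations makes the
source unique up to null sets (`HelmholtzDistrib.ae_eq`).

For the pointwise statement, the kernel is split into a singular part near the origin and a C² part.
The Hessian of the singular part has size |z|^{-d}, which just fails to be integrable. The
regularised Hessians have integral zero, so f(x - z) may be replaced by f(x - z) - f(x), and Hölder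
continuity restores integrability, uniformly in x (`SingularProfile.contDiffOn_integral`). The
classical Laplacian of the potential is never computed: a C² weak solution with continuous source is
a classical one (`HelmholtzDistrib.eq_at`). -/

/-- The real inner product, with values in `ℂ`, as a continuous bilinear map. -/
def innerC (d : ℕ) :
    EuclideanSpace ℝ (Fin d) →L[ℝ] EuclideanSpace ℝ (Fin d) →L[ℝ] ℂ :=
  (ContinuousLinearMap.compL ℝ (EuclideanSpace ℝ (Fin d)) ℝ ℂ Complex.ofRealCLM).comp
    (innerSL ℝ)

@[simp] lemma innerC_apply {d : ℕ} (x y : EuclideanSpace ℝ (Fin d)) :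
    innerC d x y = ((⟪x, y⟫ : ℝ) : ℂ) := rfl

/-- The regularised radial kernel `z ↦ H (|z|² + δ)`. -/
def radial {d : ℕ} (H : ℝ → ℂ) (δ : ℝ) (z : EuclideanSpace ℝ (Fin d)) : ℂ := H (‖z‖ ^ 2 + δ)

/-- The derivative of `radial H δ` when `H' = H1`. -/
def radialD {d : ℕ} (H1 : ℝ → ℂ) (δ : ℝ) (z : EuclideanSpace ℝ (Fin d)) :
    EuclideanSpace ℝ (Fin d) →L[ℝ] ℂ :=
  (2 * H1 (‖z‖ ^ 2 + δ)) • innerC d z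

/-- The second derivative of `radial H δ` when `H' = H1` and `H1' = H2`. -/
def radialDD {d : ℕ} (H1 H2 : ℝ → ℂ) (δ : ℝ) (z : EuclideanSpace ℝ (Fin d)) :
    EuclideanSpace ℝ (Fin d) →L[ℝ] EuclideanSpace ℝ (Fin d) →L[ℝ] ℂ :=
  (2 * H1 (‖z‖ ^ 2 + δ)) • innerC d +
    (4 * H2 (‖z‖ ^ 2 + δ)) • (innerC d z).smulRight (innerC d z)

/-! ### Calculus of radial functions of the squared norm. -/

section Calculus

variable {d : ℕ} {H H1 H2 : ℝ → ℂ} {δ : ℝ} {z : EuclideanSpace ℝ (Fin d)}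

lemma hasFDerivAt_norm_sq_add (z : EuclideanSpace ℝ (Fin d)) (δ : ℝ) :
    HasFDerivAt (fun z : EuclideanSpace ℝ (Fin d) => ‖z‖ ^ 2 + δ) (2 • innerSL ℝ z) z :=
  (hasStrictFDerivAt_norm_sq z).hasFDerivAt.add_const δ

lemma hasFDerivAt_radial (h : HasDerivAt H (H1 (‖z‖ ^ 2 + δ)) (‖z‖ ^ 2 + δ)) :
    HasFDerivAt (radial H δ) (radialD H1 δ z) z := by
  refine (h.hasFDerivAt.comp z (hasFDerivAt_norm_sq_add z δ)).congr_fderiv ?_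
  ext v
  simp [radialD]
  ring

lemma hasFDerivAt_radialD (h : HasDerivAt H1 (H2 (‖z‖ ^ 2 + δ)) (‖z‖ ^ 2 + δ)) :
    HasFDerivAt (radialD H1 δ) (radialDD H1 H2 δ z) z := by
  have h1 := (h.hasFDerivAt.comp z (hasFDerivAt_norm_sq_add z δ)).const_smul (2 : ℂ)
  have h2 := h1.smul (innerC d).hasFDerivAt
  refine h2.congr_fderiv ?_
  ext v w
  simp [radialDD]
  ring

lemma norm_innerC_le (d : ℕ) : ‖innerC d‖ ≤ 1 := by
  refine ContinuousLinearMap.opNorm_le_bound₂ _ zero_le_one fun x y => ?_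
  simpa using abs_real_inner_le_norm x y

lemma norm_innerC_apply_le (z : EuclideanSpace ℝ (Fin d)) : ‖innerC d z‖ ≤ ‖z‖ := by
  simpa using (innerC d).le_of_opNorm_le (norm_innerC_le d) z

lemma norm_radialD_le (H1 : ℝ → ℂ) (δ : ℝ) (z : EuclideanSpace ℝ (Fin d)) :
    ‖radialD H1 δ z‖ ≤ 2 * ‖z‖ * ‖H1 (‖z‖ ^ 2 + δ)‖ := by
  rw [radialD, norm_smul, norm_mul, Complex.norm_ofNat, mul_right_comm]
  gcongr
  exact norm_innerC_apply_le z

set_option maxSynthPendingDepth 3 in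
lemma norm_radialDD_le (H1 H2 : ℝ → ℂ) (δ : ℝ) (z : EuclideanSpace ℝ (Fin d)) :
    ‖radialDD H1 H2 δ z‖ ≤ 2 * ‖H1 (‖z‖ ^ 2 + δ)‖ + 4 * ‖z‖ ^ 2 * ‖H2 (‖z‖ ^ 2 + δ)‖ := by
  refine (norm_add_le ((2 * H1 (‖z‖ ^ 2 + δ)) • innerC d)
    ((4 * H2 (‖z‖ ^ 2 + δ)) • (innerC d z).smulRight (innerC d z))).trans (add_le_add ?_ ?_)
  · rw [norm_smul, norm_mul, Complex.norm_ofNat]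
    exact mul_le_of_le_one_right (by positivity) (norm_innerC_le d)
  · rw [norm_smul, norm_mul, Complex.norm_ofNat, mul_right_comm]
    gcongr
    refine ContinuousLinearMap.opNorm_le_bound _ (by positivity) fun w => ?_
    rw [ContinuousLinearMap.smulRight_apply, norm_smul]
    have h1 := (innerC d z).le_of_opNorm_le (norm_innerC_apply_le z) w
    calc ‖innerC d z w‖ * ‖innerC d z‖ ≤ (‖z‖ * ‖w‖) * ‖z‖ := by
          gcongr
          exact norm_innerC_apply_le z
      _ = ‖z‖ ^ 2 * ‖w‖ := by ring

lemma laplacian_eq_sum_fderiv {u : EuclideanSpace ℝ (Fin d) → ℂ} (x : EuclideanSpace ℝ (Fin d)) :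
    Δ u x = ∑ i, fderiv ℝ (fderiv ℝ u) x (EuclideanSpace.basisFun (Fin d) ℝ i)
      (EuclideanSpace.basisFun (Fin d) ℝ i) := by
  rw [InnerProductSpace.laplacian_eq_iteratedFDeriv_orthonormalBasis u
    (EuclideanSpace.basisFun (Fin d) ℝ)]
  simp [iteratedFDeriv_two_apply]

lemma laplacian_eq_of_hasFDerivAt {u : EuclideanSpace ℝ (Fin d) → ℂ}
    {u1 : EuclideanSpace ℝ (Fin d) → EuclideanSpace ℝ (Fin d) →L[ℝ] ℂ}
    {u2 : EuclideanSpace ℝ (Fin d) →L[ℝ] EuclideanSpace ℝ (Fin d) →L[ℝ] ℂ}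
    {x : EuclideanSpace ℝ (Fin d)}
    (h1 : ∀ᶠ y in 𝓝 x, HasFDerivAt u (u1 y) y) (h2 : HasFDerivAt u1 u2 x) :
    Δ u x = ∑ i, u2 (EuclideanSpace.basisFun (Fin d) ℝ i)
      (EuclideanSpace.basisFun (Fin d) ℝ i) := by
  rw [laplacian_eq_sum_fderiv]
  have : fderiv ℝ u =ᶠ[𝓝 x] u1 := h1.mono fun y hy => hy.fderiv
  rw [this.fderiv_eq, h2.fderiv]

/-- Trace of the Hessian: the inner product contributes d and the rank-one term |z|². The factor is
|z|² and not |z|² + δ; this mismatch later produces the approximate identity. -/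
lemma sum_radialDD (H1 H2 : ℝ → ℂ) (δ : ℝ) (z : EuclideanSpace ℝ (Fin d)) :
    ∑ i, radialDD H1 H2 δ z (EuclideanSpace.basisFun (Fin d) ℝ i)
      (EuclideanSpace.basisFun (Fin d) ℝ i) =
    2 * d * H1 (‖z‖ ^ 2 + δ) + 4 * (‖z‖ ^ 2 : ℝ) * H2 (‖z‖ ^ 2 + δ) := by
  have : ((‖z‖ ^ 2 : ℝ) : ℂ) = ∑ i, (z i : ℂ) * z i := by
    rw [EuclideanSpace.real_norm_sq_eq]
    push_cast
    simp [pow_two]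
  simp only [radialDD, add_apply, smul_apply,
    innerC_apply, ContinuousLinearMap.smulRight_apply, Finset.sum_add_distrib, this,
    Finset.mul_sum, Finset.sum_mul]
  congr 1
  · simp
    ring
  · refine Finset.sum_congr rfl fun i _ => ?_
    simp [EuclideanSpace.inner_single_right]
    ring

/-- The Laplacian of a regularised radial function. -/
lemma laplacian_radial (hδ : 0 < δ) (h1 : ∀ t, 0 < t → HasDerivAt H (H1 t) t)
    (h2 : ∀ t, 0 < t → HasDerivAt H1 (H2 t) t) (z : EuclideanSpace ℝ (Fin d)) :
    Δ (radial H δ) z =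
      2 * d * H1 (‖z‖ ^ 2 + δ) + 4 * (‖z‖ ^ 2 : ℝ) * H2 (‖z‖ ^ 2 + δ) := by
  rw [laplacian_eq_of_hasFDerivAt
    (Eventually.of_forall fun y => hasFDerivAt_radial (h1 _ (by positivity)))
    (hasFDerivAt_radialD (h2 _ (by positivity))), sum_radialDD]

lemma contDiffOn_two_of_hasDerivAt {s : Set ℝ} (hs : IsOpen s)
    (h1 : ∀ t ∈ s, HasDerivAt H (H1 t) t) (h2 : ∀ t ∈ s, HasDerivAt H1 (H2 t) t)
    (hc : ContinuousOn H2 s) : ContDiffOn ℝ 2 H s := by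
  have e1 : EqOn (deriv H) H1 s := fun t ht => (h1 t ht).deriv
  have e2 : EqOn (deriv H1) H2 s := fun t ht => (h2 t ht).deriv
  have c1 : ContDiffOn ℝ 1 H1 s := by
    rw [show (1 : WithTop ℕ∞) = 0 + 1 by simp, contDiffOn_succ_iff_deriv_of_isOpen hs]
    refine ⟨fun t ht => (h2 t ht).differentiableAt.differentiableWithinAt, by simp, ?_⟩
    rw [contDiffOn_zero]
    exact hc.congr e2
  rw [show (2 : WithTop ℕ∞) = 1 + 1 by norm_num, contDiffOn_succ_iff_deriv_of_isOpen hs]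
  exact ⟨fun t ht => (h1 t ht).differentiableAt.differentiableWithinAt, by simp, c1.congr e1⟩

/-- For δ > 0 the argument |z|² + δ stays in the open half-line, so the singularity at the origin is
never met. -/
lemma contDiff_radial {n : ℕ∞} (h : ContDiffOn ℝ n H (Ioi 0)) (hδ : 0 < δ) :
    ContDiff ℝ n (radial H δ : EuclideanSpace ℝ (Fin d) → ℂ) := by
  have h1 : ContDiff ℝ n fun z : EuclideanSpace ℝ (Fin d) => ‖z‖ ^ 2 + δ :=
    (contDiff_norm_sq ℝ).add contDiff_const
  rw [← contDiffOn_univ] at h1 ⊢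
  exact h.comp h1 fun z _ => by simp only [mem_Ioi]; positivity

end Calculus

/-! ### Green's second identity and the Helmholtz operator on test functions. -/

section Green

variable {d : ℕ}

/-- The product of a function which is continuous on a neighbourhood of the support of a continuous
compactly supported function with the latter is integrable. -/
lemma integrable_mul_of_continuousAt {u w : EuclideanSpace ℝ (Fin d) → ℂ}
    (hw : Continuous w) (hc : HasCompactSupport w)
    (hu : ∀ x ∈ tsupport w, ContinuousAt u x) : Integrable fun x => u x * w x := by
  have : Continuous fun x => u x * w x := by
    rw [continuous_iff_continuousAt]
    intro x
    by_cases hx : x ∈ tsupport w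
    · exact (hu x hx).mul hw.continuousAt
    · have h0 : (fun x => u x * w x) =ᶠ[𝓝 x] fun _ => 0 := by
        filter_upwards [notMem_tsupport_iff_eventuallyEq.mp hx] with y hy
        simp [hy]
      exact (continuousAt_congr h0).mpr continuousAt_const
  exact this.integrable_of_hasCompactSupport (hc.mul_left)

/-- **Green's second identity**, for a function which is `C²` near the support of a compactly
supported test function. -/
lemma integral_mul_laplacian {u φ : EuclideanSpace ℝ (Fin d) → ℂ} (hφ : ContDiff ℝ 2 φ)
    (hc : HasCompactSupport φ) (hu : ∀ x ∈ tsupport φ, ContDiffAt ℝ 2 u x) :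
    ∫ x, u x * Δ φ x = ∫ x, Δ u x * φ x := by
  have two : (1 : WithTop ℕ∞) + 1 ≤ 2 := by norm_num
  have hφ1 : ContDiff ℝ 1 (fderiv ℝ φ) := hφ.fderiv_right two
  have hu1 : ∀ x ∈ tsupport φ, ContDiffAt ℝ 1 (fderiv ℝ u) x :=
    fun x hx => (hu x hx).fderiv_right two
  have hsub : ∀ v, tsupport (fun x => fderiv ℝ φ x v) ⊆ tsupport φ := fun v =>
    (tsupport_fderiv_apply_subset ℝ v)
  have hsub2 : ∀ v w, tsupport (fun x => fderiv ℝ (fderiv ℝ φ) x v w) ⊆ tsupport φ := by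
    intro v w
    have h1 : Function.support (fun x => fderiv ℝ (fderiv ℝ φ) x v w) ⊆
        Function.support (fderiv ℝ (fderiv ℝ φ)) := by
      intro x hx h
      simp [h] at hx
    have h2 : tsupport (fderiv ℝ (fderiv ℝ φ)) ⊆ tsupport (fderiv ℝ φ) :=
      tsupport_fderiv_subset ℝ
    exact (closure_mono h1).trans (h2.trans (tsupport_fderiv_subset ℝ))
  have cφ1 : ∀ v, Continuous fun x => fderiv ℝ φ x v := fun v => by
    have := hφ1.continuous
    fun_prop
  have cφ2 : ∀ v w, Continuous fun x => fderiv ℝ (fderiv ℝ φ) x v w := fun v w => by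
    have := hφ1.continuous_fderiv one_ne_zero
    fun_prop
  have cu1 : ∀ v, ∀ x ∈ tsupport φ, ContinuousAt (fun x => fderiv ℝ u x v) x := fun v x hx =>
    (hu1 x hx).continuousAt.clm_apply continuousAt_const
  have cu2 : ∀ v w, ∀ x ∈ tsupport φ, ContinuousAt (fun x => fderiv ℝ (fderiv ℝ u) x v w) x :=
    fun v w x hx => (((hu1 x hx).fderiv_right (m := 0) (by simp)).continuousAt.clm_apply
      continuousAt_const).clm_apply continuousAt_const
  have hc1 : ∀ v, HasCompactSupport fun x => fderiv ℝ φ x v := fun v =>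
    hc.of_isClosed_subset (isClosed_tsupport _) (hsub v)
  have hc2 : ∀ v w, HasCompactSupport fun x => fderiv ℝ (fderiv ℝ φ) x v w := fun v w =>
    hc.of_isClosed_subset (isClosed_tsupport _) (hsub2 v w)
  have i02 : ∀ v, Integrable fun x => u x * fderiv ℝ (fderiv ℝ φ) x v v := fun v =>
    integrable_mul_of_continuousAt (cφ2 v v) (hc2 v v)
      fun x hx => (hu x (hsub2 v v hx)).continuousAt
  have i11 : ∀ v, Integrable fun x => fderiv ℝ u x v * fderiv ℝ φ x v := fun v =>
    integrable_mul_of_continuousAt (cφ1 v) (hc1 v) fun x hx => cu1 v x (hsub v hx)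
  have i01 : ∀ v, Integrable fun x => u x * fderiv ℝ φ x v := fun v =>
    integrable_mul_of_continuousAt (cφ1 v) (hc1 v) fun x hx => (hu x (hsub v hx)).continuousAt
  have i10 : ∀ v, Integrable fun x => fderiv ℝ u x v * φ x := fun v =>
    integrable_mul_of_continuousAt hφ.continuous hc (cu1 v)
  have i20 : ∀ v, Integrable fun x => fderiv ℝ (fderiv ℝ u) x v v * φ x := fun v =>
    integrable_mul_of_continuousAt hφ.continuous hc (cu2 v v)
  have eval : ∀ v : EuclideanSpace ℝ (Fin d), ∀ {w : EuclideanSpace ℝ (Fin d) → ℂ} {x},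
      ContDiffAt ℝ 1 (fderiv ℝ w) x →
      HasFDerivAt (fun x => fderiv ℝ w x v)
        ((ContinuousLinearMap.apply ℝ ℂ v).comp (fderiv ℝ (fderiv ℝ w) x)) x := fun v w x h =>
    (ContinuousLinearMap.apply ℝ ℂ v).hasFDerivAt.comp x
      (h.differentiableAt one_ne_zero).hasFDerivAt
  -- Two integrations by parts in the direction v. Differentiability of u and of its derivative is
  -- needed only on the support of φ, where `hu` provides it.
  have key : ∀ v, ∫ x, u x * fderiv ℝ (fderiv ℝ φ) x v v =
      ∫ x, fderiv ℝ (fderiv ℝ u) x v v * φ x := by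
    intro v
    have e1 := integral_bilinear_hasFDerivAt_right_eq_neg_left_of_integrable (μ := volume) (v := v)
      (B := ContinuousLinearMap.mul ℝ ℂ) (f := u) (f' := fderiv ℝ u)
      (g := fun x => fderiv ℝ φ x v)
      (g' := fun x => (ContinuousLinearMap.apply ℝ ℂ v).comp (fderiv ℝ (fderiv ℝ φ) x))
      (i11 v) (i02 v) (i01 v)
      (fun x hx => ((hu x (hsub v hx)).differentiableAt two_ne_zero).hasFDerivAt)
      (fun x _ => eval v hφ1.contDiffAt)
    have e2 := integral_bilinear_hasFDerivAt_right_eq_neg_left_of_integrable (μ := volume) (v := v)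
      (B := ContinuousLinearMap.mul ℝ ℂ) (f := fun x => fderiv ℝ u x v)
      (f' := fun x => (ContinuousLinearMap.apply ℝ ℂ v).comp (fderiv ℝ (fderiv ℝ u) x))
      (g := φ) (g' := fderiv ℝ φ)
      (i20 v) (i11 v) (i10 v)
      (fun x hx => eval v (hu1 x hx))
      (fun x _ => (hφ.contDiffAt.differentiableAt two_ne_zero).hasFDerivAt)
    simp only [ContinuousLinearMap.mul_apply', ContinuousLinearMap.comp_apply,
      ContinuousLinearMap.apply_apply] at e1 e2
    rw [e1, e2, neg_neg]
  simp only [laplacian_eq_sum_fderiv, Finset.mul_sum, Finset.sum_mul]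
  rw [integral_finsetSum _ fun i _ => i02 _, integral_finsetSum _ fun i _ => i20 _]
  exact Finset.sum_congr rfl fun i _ => key _

lemma continuousAt_laplacian {u : EuclideanSpace ℝ (Fin d) → ℂ} {x : EuclideanSpace ℝ (Fin d)}
    (hu : ContDiffAt ℝ 2 u x) : ContinuousAt (Δ u) x := by
  have h1 : ContDiffAt ℝ 1 (fderiv ℝ u) x := hu.fderiv_right (by norm_num)
  have h2 := (h1.fderiv_right (m := 0) (by simp)).continuousAt
  rw [show Δ u = fun y => _ from funext fun y => laplacian_eq_sum_fderiv y]
  exact tendsto_finsetSum _ fun i _ =>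
    (h2.clm_apply continuousAt_const).clm_apply continuousAt_const

lemma hasCompactSupport_laplacian {u : EuclideanSpace ℝ (Fin d) → ℂ} (hu : HasCompactSupport u) :
    HasCompactSupport (Δ u) := by
  refine hu.mono' fun x hx => ?_
  by_contra h
  apply hx
  have h0 : u =ᶠ[𝓝 x] fun _ => (0 : ℂ) := notMem_tsupport_iff_eventuallyEq.mp h
  rw [(InnerProductSpace.laplacian_congr_nhds h0).eq_of_nhds]
  simp

lemma continuous_helmholtz {φ : EuclideanSpace ℝ (Fin d) → ℂ} (hφ : ContDiff ℝ 2 φ) (k : ℝ) :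
    Continuous fun x => Δ φ x + (k : ℂ) ^ 2 * φ x :=
  (continuous_iff_continuousAt.mpr fun _ => continuousAt_laplacian hφ.contDiffAt).add
    (continuous_const.mul hφ.continuous)

lemma hasCompactSupport_helmholtz {φ : EuclideanSpace ℝ (Fin d) → ℂ} (hc : HasCompactSupport φ)
    (k : ℝ) : HasCompactSupport fun x => Δ φ x + (k : ℂ) ^ 2 * φ x :=
  (hasCompactSupport_laplacian hc).add hc.mul_left

lemma integral_mul_helmholtz {u φ : EuclideanSpace ℝ (Fin d) → ℂ} (k : ℝ) (hφ : ContDiff ℝ 2 φ)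
    (hc : HasCompactSupport φ) (hu : ∀ x ∈ tsupport φ, ContDiffAt ℝ 2 u x) :
    ∫ x, u x * (Δ φ x + (k : ℂ) ^ 2 * φ x) = ∫ x, (Δ u x + (k : ℂ) ^ 2 * u x) * φ x := by
  have hL : Continuous (Δ φ) :=
    continuous_iff_continuousAt.mpr fun _ => continuousAt_laplacian hφ.contDiffAt
  have hLs : tsupport (Δ φ) ⊆ tsupport φ := by
    refine closure_minimal (fun x hx => ?_) (isClosed_tsupport _)
    by_contra h
    apply hx
    have h0 : φ =ᶠ[𝓝 x] fun _ => (0 : ℂ) := notMem_tsupport_iff_eventuallyEq.mp h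
    rw [(InnerProductSpace.laplacian_congr_nhds h0).eq_of_nhds]
    simp
  have i1 : Integrable fun x => u x * Δ φ x :=
    integrable_mul_of_continuousAt hL (hasCompactSupport_laplacian hc)
      fun x hx => (hu x (hLs hx)).continuousAt
  have i2 : Integrable fun x => u x * φ x :=
    integrable_mul_of_continuousAt hφ.continuous hc fun x hx => (hu x hx).continuousAt
  have i3 : Integrable fun x => Δ u x * φ x :=
    integrable_mul_of_continuousAt hφ.continuous hc fun x hx => continuousAt_laplacian (hu x hx)
  have e1 : (fun x => u x * (Δ φ x + (k : ℂ) ^ 2 * φ x)) =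
      fun x => u x * Δ φ x + (k : ℂ) ^ 2 * (u x * φ x) := by ext x; ring
  have e2 : (fun x => (Δ u x + (k : ℂ) ^ 2 * u x) * φ x) =
      fun x => Δ u x * φ x + (k : ℂ) ^ 2 * (u x * φ x) := by ext x; ring
  rw [e1, e2, integral_add i1 (i2.const_mul _), integral_add i3 (i2.const_mul _),
    integral_mul_laplacian hφ hc hu]

end Green

/-! ### Radial fundamental solutions: axioms, bounds and the mass of the model kernel. -/

section Profile

/-- The limit controls g near 0, and compactness controls it on the rest of the interval. -/
lemma exists_bound_Ioc {g : ℝ → ℂ} {c : ℂ} (hg : ContinuousOn g (Ioi 0))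
    (hl : Tendsto g (𝓝[>] 0) (𝓝 c)) (T : ℝ) : ∃ C, 0 ≤ C ∧ ∀ t, 0 < t → t ≤ T → ‖g t‖ ≤ C := by
  have h1 : ∀ᶠ t in 𝓝[>] (0 : ℝ), ‖g t‖ < ‖c‖ + 1 :=
    hl.norm.eventually (gt_mem_nhds (lt_add_one _))
  obtain ⟨s, hs, hs'⟩ := mem_nhdsGT_iff_exists_Ioo_subset.mp h1
  obtain ⟨C, hC⟩ := (isCompact_Icc (a := s) (b := T)).exists_bound_of_continuousOn
    (hg.mono fun t ht => lt_of_lt_of_le hs ht.1)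
  refine ⟨max (‖c‖ + 1) C, le_max_of_le_left (by positivity), fun t ht htT => ?_⟩
  rcases lt_or_ge t s with h | h
  · exact le_max_of_le_left (le_of_lt (hs' ⟨ht, h⟩))
  · exact le_max_of_le_right (hC t ⟨h, htT⟩)

/-- `h (|z|²)` is an outgoing-type fundamental solution of the Helmholtz equation in `ℝᵈ`: `h` solves
the radial equation in the variable `t = |z|²` and has the normalised singularity at `0`. -/
structure HelmholtzProfile (d : ℕ) (k : ℝ) (h h1 h2 : ℝ → ℂ) : Prop where
  deriv₁ : ∀ t, 0 < t → HasDerivAt h (h1 t) t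
  deriv₂ : ∀ t, 0 < t → HasDerivAt h1 (h2 t) t
  ode : ∀ t : ℝ, 0 < t → 4 * (t : ℂ) * h2 t + 2 * d * h1 t + (k : ℂ) ^ 2 * h t = 0
  lim₀ : ∃ c, Tendsto (fun t : ℝ => ((√t ^ (d - 1) : ℝ) : ℂ) * h t) (𝓝[>] 0) (𝓝 c)
  lim₁ : Tendsto (fun t : ℝ => ((√t ^ d : ℝ) : ℂ) * h1 t) (𝓝[>] 0)
    (𝓝 (-(1 / (2 * d * (volume.real (Metric.ball (0 : EuclideanSpace ℝ (Fin d)) 1) : ℂ)))))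

variable {d : ℕ} {k : ℝ} {h h1 h2 : ℝ → ℂ}

namespace HelmholtzProfile

lemma continuousOn₀ (P : HelmholtzProfile d k h h1 h2) : ContinuousOn h (Ioi 0) :=
  fun t ht => (P.deriv₁ t ht).continuousAt.continuousWithinAt

lemma continuousOn₁ (P : HelmholtzProfile d k h h1 h2) : ContinuousOn h1 (Ioi 0) :=
  fun t ht => (P.deriv₂ t ht).continuousAt.continuousWithinAt

lemma eq₂ (P : HelmholtzProfile d k h h1 h2) {t : ℝ} (ht : 0 < t) :
    h2 t = -(2 * d * h1 t + (k : ℂ) ^ 2 * h t) / (4 * t) := by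
  have h4 : (4 : ℂ) * t ≠ 0 := by simpa using ht.ne'
  rw [eq_div_iff h4]
  linear_combination P.ode t ht

lemma continuousOn₂ (P : HelmholtzProfile d k h h1 h2) : ContinuousOn h2 (Ioi 0) := by
  have : ContinuousOn (fun t : ℝ => -(2 * d * h1 t + (k : ℂ) ^ 2 * h t) / (4 * t)) (Ioi 0) := by
    refine ContinuousOn.div ?_ (by fun_prop) fun t ht => ?_
    · exact ((continuousOn_const.mul P.continuousOn₁).add
        (continuousOn_const.mul P.continuousOn₀)).neg
    · simpa using (ne_of_gt ht)
  exact this.congr fun t ht => P.eq₂ ht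

/-- The radial equation expresses h2 through h1 and h. The weight `√t ^ (d + 2)` leaves -(2d/4)
times the limit of `lim₁`; the h term carries one spare factor √t and disappears. The value in
`lim₁` says that the flux of the gradient of h(|z|²) through small spheres tends to -1. In `lim₀`
the power d - 1, one more than the Newtonian d - 2, absorbs the logarithm in the plane. -/
lemma lim₂ (P : HelmholtzProfile d k h h1 h2) (hd : 0 < d) :
    Tendsto (fun t : ℝ => ((√t ^ (d + 2) : ℝ) : ℂ) * h2 t) (𝓝[>] 0)
      (𝓝 (1 / (4 * (volume.real (Metric.ball (0 : EuclideanSpace ℝ (Fin d)) 1) : ℂ)))) := by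
  obtain ⟨c, hc⟩ := P.lim₀
  have hs : Tendsto (fun t : ℝ => ((√t : ℝ) : ℂ)) (𝓝[>] 0) (𝓝 0) := by
    have : Continuous fun t : ℝ => ((√t : ℝ) : ℂ) := by fun_prop
    simpa using (this.tendsto 0).mono_left nhdsWithin_le_nhds
  have hl := (((P.lim₁.const_mul (2 * d : ℂ)).add
    ((hs.mul hc).const_mul ((k : ℂ) ^ 2))).neg).div_const 4
  have hd' : (d : ℂ) ≠ 0 := by exact_mod_cast hd.ne'
  have hv : (volume.real (Metric.ball (0 : EuclideanSpace ℝ (Fin d)) 1) : ℂ) ≠ 0 := by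
    have := Metric.measure_ball_pos volume (0 : EuclideanSpace ℝ (Fin d)) one_pos
    exact_mod_cast (ENNReal.toReal_pos this.ne' measure_ball_lt_top.ne).ne'
  have e : -(2 * (d : ℂ) *
      -(1 / (2 * d * (volume.real (Metric.ball (0 : EuclideanSpace ℝ (Fin d)) 1) : ℂ))) +
      (k : ℂ) ^ 2 * (0 * c)) / 4 =
      1 / (4 * (volume.real (Metric.ball (0 : EuclideanSpace ℝ (Fin d)) 1) : ℂ)) := by
    field_simp
    ring
  rw [e] at hl
  refine hl.congr' ?_
  filter_upwards [self_mem_nhdsWithin] with t ht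
  have ht' : 0 < t := ht
  have h4 : (t : ℂ) ≠ 0 := by simpa using ht'.ne'
  have hst : ((√t : ℝ) : ℂ) ^ 2 = t := by exact_mod_cast Real.sq_sqrt ht'.le
  obtain ⟨n, rfl⟩ : ∃ n, d = n + 1 := ⟨d - 1, by omega⟩
  rw [P.eq₂ ht']
  push_cast
  rw [pow_add ((√t : ℝ) : ℂ) (n + 1) 2, hst, pow_succ]
  field_simp

lemma exists_bound (P : HelmholtzProfile d k h h1 h2) (hd : 0 < d) (T : ℝ) :
    ∃ C, 0 ≤ C ∧ ∀ t, 0 < t → t ≤ T → ‖h t‖ * √t ^ (d - 1) ≤ C ∧ ‖h1 t‖ * √t ^ d ≤ C ∧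
      ‖h2 t‖ * √t ^ (d + 2) ≤ C := by
  have hcont : ∀ n, ContinuousOn (fun t : ℝ => ((√t ^ n : ℝ) : ℂ)) (Ioi 0) := fun n => by fun_prop
  obtain ⟨c, hc⟩ := P.lim₀
  obtain ⟨C0, hC0, H0⟩ := exists_bound_Ioc ((hcont (d - 1)).mul P.continuousOn₀) hc T
  obtain ⟨C1, hC1, H1⟩ := exists_bound_Ioc ((hcont d).mul P.continuousOn₁) P.lim₁ T
  obtain ⟨C2, hC2, H2⟩ := exists_bound_Ioc ((hcont (d + 2)).mul P.continuousOn₂) (P.lim₂ hd) T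
  have nrm : ∀ (t : ℝ) (n : ℕ) (x : ℂ), ‖((√t ^ n : ℝ) : ℂ) * x‖ = ‖x‖ * √t ^ n := by
    intro t n x
    rw [norm_mul, Complex.norm_real, Real.norm_of_nonneg (by positivity), mul_comm]
  replace H0 := fun t ht htT => (nrm t _ _).symm.trans_le (H0 t ht htT)
  replace H1 := fun t ht htT => (nrm t _ _).symm.trans_le (H1 t ht htT)
  replace H2 := fun t ht htT => (nrm t _ _).symm.trans_le (H2 t ht htT)
  refine ⟨max C0 (max C1 C2), le_max_of_le_left hC0, fun t ht htT => ⟨?_, ?_, ?_⟩⟩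
  · exact le_max_of_le_left (H0 t ht htT)
  · exact le_max_of_le_right (le_max_of_le_left (H1 t ht htT))
  · exact le_max_of_le_right (le_max_of_le_right (H2 t ht htT))

lemma contDiffOn (P : HelmholtzProfile d k h h1 h2) : ContDiffOn ℝ 2 h (Ioi 0) :=
  contDiffOn_two_of_hasDerivAt isOpen_Ioi P.deriv₁ P.deriv₂ P.continuousOn₂

end HelmholtzProfile

/-- Powers of the norm above the critical exponent are locally integrable. -/
lemma integrableOn_norm_pow (hd : 0 < d) {a R : ℝ} (ha : -d < a) :
    IntegrableOn (fun z : EuclideanSpace ℝ (Fin d) => ‖z‖ ^ a) (Metric.closedBall 0 R) := by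
  have : Nontrivial (EuclideanSpace ℝ (Fin d)) := by
    have : Nonempty (Fin d) := ⟨⟨0, hd⟩⟩
    infer_instance
  refine IntegrableOn.mono_set ?_
    (Metric.closedBall_subset_ball (lt_add_one R))
  rw [integrableOn_fun_norm_addHaar volume (f := fun r : ℝ => r ^ a)]
  rcases le_or_gt (R + 1) 0 with hR | hR
  · rw [Ioo_eq_empty (not_lt.mpr hR)]
    exact integrableOn_empty
  have : IntegrableOn (fun y : ℝ => y ^ (a + d - 1)) (Ioo 0 (R + 1)) := by
    have := intervalIntegral.intervalIntegrable_rpow' (r := a + d - 1) (a := 0) (b := R + 1)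
      (by linarith)
    rw [intervalIntegrable_iff_integrableOn_Ioo_of_le hR.le] at this
    exact this
  refine this.congr_fun (fun y hy => ?_) measurableSet_Ioo
  have hy0 : 0 < y := hy.1
  simp only [finrank_euclideanSpace, Fintype.card_fin, smul_eq_mul]
  rw [← Real.rpow_natCast, ← Real.rpow_add hy0, Nat.cast_sub (by omega)]
  congr 1
  push_cast
  ring

/-- `∫ (1 + |w|²)^(-(d+2)/2) dw` is the volume of the unit ball. -/
lemma integral_inv_sqrt_pow (hd : 0 < d) :
    Integrable (fun w : EuclideanSpace ℝ (Fin d) => (√(‖w‖ ^ 2 + 1) ^ (d + 2))⁻¹) ∧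
    ∫ w : EuclideanSpace ℝ (Fin d), (√(‖w‖ ^ 2 + 1) ^ (d + 2))⁻¹ =
      volume.real (Metric.ball (0 : EuclideanSpace ℝ (Fin d)) 1) := by
  have : Nontrivial (EuclideanSpace ℝ (Fin d)) := by
    have : Nonempty (Fin d) := ⟨⟨0, hd⟩⟩
    infer_instance
  have hdR : (d : ℝ) ≠ 0 := by exact_mod_cast hd.ne'
  set s : ℝ → ℝ := fun y => √(y ^ 2 + 1) with hs
  have spos : ∀ y, 0 < s y := fun y => Real.sqrt_pos.mpr (by positivity)
  have ssq : ∀ y, s y ^ 2 = y ^ 2 + 1 := fun y => Real.sq_sqrt (by positivity)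
  have sder : ∀ y, HasDerivAt s (y / s y) y := fun y => by
    have h1 : HasDerivAt (fun y : ℝ => y ^ 2 + 1) (2 * y) y := by
      simpa using (hasDerivAt_pow 2 y).add_const (1 : ℝ)
    have := h1.sqrt (by positivity)
    convert this using 1
    change y / √(y ^ 2 + 1) = _
    rw [mul_div_mul_left _ _ two_ne_zero]
  -- The radial integrand has the primitive (y / s)^d / d, because (y / s)' = s⁻³. It tends to 1/d
  -- at infinity, which cancels the dimension factor of polar coordinates.
  have der : ∀ y, HasDerivAt (fun y => (y / s y) ^ d / d) (y ^ (d - 1) • (s y ^ (d + 2))⁻¹) y := by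
    intro y
    have hq : HasDerivAt (fun y => y / s y) ((s y ^ 3)⁻¹) y := by
      refine ((hasDerivAt_id y).div (sder y) (spos y).ne').congr_deriv ?_
      have := (spos y).ne'
      simp only [id]
      field_simp
      linarith [ssq y]
    refine ((hq.pow d).div_const (d : ℝ)).congr_deriv ?_
    obtain ⟨n, rfl⟩ : ∃ n, d = n + 1 := ⟨d - 1, by omega⟩
    have := (spos y).ne'
    simp only [Nat.add_sub_cancel, smul_eq_mul, div_pow]
    field_simp
    ring
  have lim : Tendsto (fun y => (y / s y) ^ d / d) atTop (𝓝 (1 / d)) := by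
    have h1 : Tendsto (fun y : ℝ => √(1 - (y ^ 2 + 1)⁻¹)) atTop (𝓝 √(1 - 0)) := by
      refine (Real.continuous_sqrt.tendsto _).comp (tendsto_const_nhds.sub ?_)
      exact tendsto_inv_atTop_zero.comp
        (tendsto_atTop_add_const_right _ _ (tendsto_pow_atTop two_ne_zero))
    have h2 : Tendsto (fun y => y / s y) atTop (𝓝 1) := by
      rw [sub_zero, Real.sqrt_one] at h1
      refine h1.congr' ?_
      filter_upwards [eventually_ge_atTop 0] with y hy
      rw [show 1 - (y ^ 2 + 1)⁻¹ = y ^ 2 / (y ^ 2 + 1) by field_simp; ring,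
        Real.sqrt_div (by positivity), Real.sqrt_sq hy]
    simpa using (h2.pow d).div_const (d : ℝ)
  have nonneg : ∀ y ∈ Ioi (0 : ℝ), 0 ≤ y ^ (d - 1) • (s y ^ (d + 2))⁻¹ := fun y hy => by
    have hy : 0 < y := hy
    have := spos y
    rw [smul_eq_mul]; positivity
  constructor
  · rw [integrable_fun_norm_addHaar volume (f := fun y : ℝ => (s y ^ (d + 2))⁻¹)]
    simp only [finrank_euclideanSpace, Fintype.card_fin]
    exact integrableOn_Ioi_deriv_of_nonneg' (fun y _ => der y) nonneg lim
  · rw [integral_fun_norm_addHaar volume (fun y : ℝ => (s y ^ (d + 2))⁻¹)]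
    simp only [finrank_euclideanSpace, Fintype.card_fin]
    rw [integral_Ioi_of_hasDerivAt_of_nonneg' (fun y _ => der y) nonneg lim]
    simp [hd.ne']
    field_simp

end Profile

/-! ### The regularised kernels and the fundamental solution. -/

section FundamentalSolution

variable {d : ℕ} {k : ℝ} {h h1 h2 : ℝ → ℂ}

/-- Negative powers decrease, so an estimate at s = √(|z|² + δ) passes to r = |z|. This makes all
later bounds uniform in δ. -/
lemma le_mul_rpow_neg_of_mul_pow_le {x C r s : ℝ} {n : ℕ} (hx : 0 ≤ x) (hr : 0 < r) (hrs : r ≤ s)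
    (hC : x * s ^ n ≤ C) : x ≤ C * r ^ (-n : ℝ) := by
  rw [Real.rpow_neg hr.le, Real.rpow_natCast, ← div_eq_mul_inv, le_div_iff₀ (by positivity)]
  exact le_trans (by gcongr) hC

lemma norm_le_sqrt_add {z : EuclideanSpace ℝ (Fin d)} {δ : ℝ} (hδ : 0 ≤ δ) :
    ‖z‖ ≤ √(‖z‖ ^ 2 + δ) := Real.le_sqrt_of_sq_le (by linarith)

lemma ae_ne_zero (hd : 0 < d) : ∀ᵐ z : EuclideanSpace ℝ (Fin d), z ≠ 0 := by
  have : Nonempty (Fin d) := ⟨⟨0, hd⟩⟩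
  have : Nontrivial (EuclideanSpace ℝ (Fin d)) := inferInstance
  exact Measure.ae_ne volume 0

lemma aestronglyMeasurable_of_continuousOn_compl_zero {F : Type*} [NormedAddCommGroup F]
    (hd : 0 < d) {g : EuclideanSpace ℝ (Fin d) → F} (hg : ContinuousOn g {0}ᶜ) :
    AEStronglyMeasurable g := by
  have h1 := hg.aestronglyMeasurable (μ := volume) (measurableSet_singleton 0).compl
  rwa [Measure.restrict_eq_self_of_ae_mem] at h1
  filter_upwards [ae_ne_zero hd] with z hz using hz

lemma continuousOn_radial (hH : ContinuousOn h (Ioi 0)) {δ : ℝ} (hδ : 0 ≤ δ) :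
    ContinuousOn (radial h δ : EuclideanSpace ℝ (Fin d) → ℂ) {0}ᶜ := by
  refine hH.comp (f := fun z : EuclideanSpace ℝ (Fin d) => ‖z‖ ^ 2 + δ) (by fun_prop) fun z hz => ?_
  have : 0 < ‖z‖ := norm_pos_iff.mpr hz
  simp only [mem_Ioi]
  positivity

lemma tendsto_radial_zero (hH : ContinuousOn h (Ioi 0)) {z : EuclideanSpace ℝ (Fin d)}
    (hz : z ≠ 0) : Tendsto (fun δ => radial h δ z) (𝓝 0) (𝓝 (radial h 0 z)) := by
  have h0 : 0 < ‖z‖ ^ 2 + 0 := by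
    have : 0 < ‖z‖ := norm_pos_iff.mpr hz
    positivity
  have h1 : ContinuousAt h (‖z‖ ^ 2 + 0) := hH.continuousAt (Ioi_mem_nhds h0)
  have h2 : Tendsto (fun δ : ℝ => ‖z‖ ^ 2 + δ) (𝓝 0) (𝓝 (‖z‖ ^ 2 + 0)) :=
    tendsto_const_nhds.add tendsto_id
  exact h1.tendsto.comp h2

lemma tendsto_sq_nhdsGT : Tendsto (fun ε : ℝ => ε ^ 2) (𝓝[>] 0) (𝓝[>] 0) := by
  refine tendsto_nhdsWithin_iff.mpr ⟨?_, ?_⟩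
  · have : Continuous fun ε : ℝ => ε ^ 2 := by fun_prop
    simpa using (this.tendsto 0).mono_left nhdsWithin_le_nhds
  · filter_upwards [self_mem_nhdsWithin] with ε hε
    have : 0 < ε := hε
    simp only [mem_Ioi]
    positivity

namespace HelmholtzProfile

/-- One integrable majorant for all δ in [0, 1], for dominated convergence as δ → 0. Profile bounds
are taken up to R² + 1 so as to cover |z|² + δ. -/
lemma exists_radial_bound (P : HelmholtzProfile d k h h1 h2) (hd : 0 < d) (R : ℝ) :
    ∃ C, 0 ≤ C ∧ ∀ δ, 0 ≤ δ → δ ≤ 1 → ∀ z : EuclideanSpace ℝ (Fin d), z ≠ 0 → ‖z‖ ≤ R →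
      ‖radial h δ z‖ ≤ C * ‖z‖ ^ (-(d - 1 : ℕ) : ℝ) := by
  obtain ⟨C, hC, H⟩ := P.exists_bound hd (R ^ 2 + 1)
  refine ⟨C, hC, fun δ hδ hδ1 z hz hzR => ?_⟩
  have hz0 : 0 < ‖z‖ := norm_pos_iff.mpr hz
  exact le_mul_rpow_neg_of_mul_pow_le (norm_nonneg _) hz0 (norm_le_sqrt_add hδ)
    (H _ (by positivity) (by gcongr)).1

lemma exponent_lt (hd : 0 < d) : (-d : ℝ) < -(d - 1 : ℕ) := by
  rw [Nat.cast_sub (by omega)]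
  push_cast
  linarith

lemma integrableOn_radial (P : HelmholtzProfile d k h h1 h2) (hd : 0 < d) (R : ℝ) :
    IntegrableOn (radial h 0 : EuclideanSpace ℝ (Fin d) → ℂ) (Metric.closedBall 0 R) := by
  obtain ⟨C, -, hC⟩ := P.exists_radial_bound hd R
  refine Integrable.mono' ((integrableOn_norm_pow hd (exponent_lt hd)).const_mul C)
    (aestronglyMeasurable_of_continuousOn_compl_zero hd
      (continuousOn_radial P.continuousOn₀ le_rfl)).restrict ?_
  filter_upwards [ae_restrict_mem measurableSet_closedBall, ae_restrict_of_ae (ae_ne_zero hd)]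
    with z hz hz0
  exact hC 0 le_rfl zero_le_one z hz0 (by simpa using hz)

lemma tendsto_integral_radial_mul (P : HelmholtzProfile d k h h1 h2) (hd : 0 < d)
    {ψ : EuclideanSpace ℝ (Fin d) → ℂ} (hψ : Continuous ψ) (hc : HasCompactSupport ψ) :
    Tendsto (fun δ => ∫ z, radial h δ z * ψ z) (𝓝[>] 0) (𝓝 (∫ z, radial h 0 z * ψ z)) := by
  obtain ⟨R, hR⟩ := hc.isCompact.isBounded.subset_closedBall 0
  obtain ⟨B, hB⟩ := hψ.bounded_above_of_compact_support hc
  obtain ⟨C, hC0, hC⟩ := P.exists_radial_bound hd R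
  have hint : Integrable ((Metric.closedBall (0 : EuclideanSpace ℝ (Fin d)) R).indicator
      fun z => C * ‖z‖ ^ (-(d - 1 : ℕ) : ℝ) * B) :=
    IntegrableOn.integrable_indicator
      (((integrableOn_norm_pow hd (exponent_lt hd)).const_mul C).mul_const B)
      measurableSet_closedBall
  refine tendsto_integral_filter_of_dominated_convergence _ ?_ ?_ hint ?_
  · filter_upwards [self_mem_nhdsWithin] with δ hδ
    exact (aestronglyMeasurable_of_continuousOn_compl_zero hd
      (continuousOn_radial P.continuousOn₀ (le_of_lt hδ))).mul hψ.aestronglyMeasurable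
  · have h1 : ∀ᶠ δ : ℝ in 𝓝[>] 0, δ ≤ 1 :=
      nhdsWithin_le_nhds (Iic_mem_nhds one_pos)
    filter_upwards [self_mem_nhdsWithin, h1] with δ hδ hδ1
    filter_upwards [ae_ne_zero hd] with z hz
    by_cases hzs : z ∈ tsupport ψ
    · have hzR := hR hzs
      rw [indicator_of_mem hzR, norm_mul]
      have := hC δ (le_of_lt hδ) hδ1 z hz (by simpa using hzR)
      have := hB z
      gcongr
    · rw [image_eq_zero_of_notMem_tsupport hzs, mul_zero, norm_zero]
      refine indicator_nonneg (fun z _ => ?_) z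
      have : 0 ≤ B := (norm_nonneg _).trans (hB 0)
      positivity
  · filter_upwards [ae_ne_zero hd] with z hz
    exact ((tendsto_radial_zero P.continuousOn₀ hz).mono_left nhdsWithin_le_nhds).mul_const _

/-- The regularised fundamental solutions form an approximate identity. -/
lemma tendsto_integral_regularized (P : HelmholtzProfile d k h h1 h2) (hd : 0 < d)
    {φ : EuclideanSpace ℝ (Fin d) → ℂ} (hφ : Continuous φ) (hc : HasCompactSupport φ) :
    Tendsto (fun ε : ℝ => ∫ z, (-4 * (ε ^ 2 : ℝ) * h2 (‖z‖ ^ 2 + ε ^ 2)) * φ z)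
      (𝓝[>] 0) (𝓝 (-φ 0)) := by
  set V : ℝ := volume.real (Metric.ball (0 : EuclideanSpace ℝ (Fin d)) 1) with hV
  have hVpos : 0 < V := ENNReal.toReal_pos
    (Metric.measure_ball_pos volume (0 : EuclideanSpace ℝ (Fin d)) one_pos).ne'
    measure_ball_lt_top.ne
  obtain ⟨R, hR⟩ := hc.isCompact.isBounded.subset_closedBall 0
  obtain ⟨B, hB⟩ := hφ.bounded_above_of_compact_support hc
  obtain ⟨C, hC0, hC⟩ := P.exists_bound hd (R ^ 2 + 1)
  obtain ⟨hI, hIV⟩ := integral_inv_sqrt_pow hd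
  -- The integrand after z = εw. The factor ε² and the Jacobian ε^d turn h2 into the weighted
  -- quantity of `lim₂` at ε²(|w|² + 1), times the fixed weight (|w|² + 1)^{-(d+2)/2}.
  let g : ℝ → EuclideanSpace ℝ (Fin d) → ℂ := fun ε w =>
    (-4 * (((√(ε ^ 2 * (‖w‖ ^ 2 + 1)) ^ (d + 2) : ℝ) : ℂ) * h2 (ε ^ 2 * (‖w‖ ^ 2 + 1))) *
      φ (ε • w)) * (((√(‖w‖ ^ 2 + 1) ^ (d + 2))⁻¹ : ℝ) : ℂ)
  have hscale : ∀ ε : ℝ, 0 < ε →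
      ∫ z, (-4 * (ε ^ 2 : ℝ) * h2 (‖z‖ ^ 2 + ε ^ 2)) * φ z = ∫ w, g ε w := by
    intro ε hε
    have h1 := Measure.integral_comp_smul_of_nonneg (μ := volume)
      (fun z : EuclideanSpace ℝ (Fin d) =>
        (-4 * (ε ^ 2 : ℝ) * h2 (‖z‖ ^ 2 + ε ^ 2)) * φ z) ε (hR := hε.le)
    have hεd : (ε ^ d : ℝ) ≠ 0 := by positivity
    rw [finrank_euclideanSpace, Fintype.card_fin, eq_inv_smul_iff₀ hεd, ← integral_smul] at h1
    rw [← h1]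
    refine integral_congr_ae (Eventually.of_forall fun w => ?_)
    have e1 : ‖ε • w‖ ^ 2 + ε ^ 2 = ε ^ 2 * (‖w‖ ^ 2 + 1) := by
      rw [norm_smul, Real.norm_of_nonneg hε.le]; ring
    have e2 : √(ε ^ 2 * (‖w‖ ^ 2 + 1)) = ε * √(‖w‖ ^ 2 + 1) := by
      rw [Real.sqrt_mul (by positivity), Real.sqrt_sq hε.le]
    have hs : ((√(‖w‖ ^ 2 + 1) : ℝ) : ℂ) ≠ 0 := by
      have : 0 < √(‖w‖ ^ 2 + 1) := Real.sqrt_pos.mpr (by positivity)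
      exact_mod_cast this.ne'
    simp only [g, e1, e2, Complex.real_smul]
    push_cast
    field_simp
    ring
  have hlim : Tendsto (fun ε => ∫ w, g ε w) (𝓝[>] 0)
      (𝓝 (∫ w : EuclideanSpace ℝ (Fin d), (-4 * (1 / (4 * (V : ℂ))) * φ ((0 : ℝ) • w)) *
        (((√(‖w‖ ^ 2 + 1) ^ (d + 2))⁻¹ : ℝ) : ℂ))) := by
    refine tendsto_integral_filter_of_dominated_convergence
      (fun w => 4 * C * B * (√(‖w‖ ^ 2 + 1) ^ (d + 2))⁻¹) ?_ ?_ (hI.const_mul _) ?_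
    · filter_upwards [self_mem_nhdsWithin] with ε hε
      have hε : 0 < ε := hε
      have c2 : Continuous fun w : EuclideanSpace ℝ (Fin d) => h2 (ε ^ 2 * (‖w‖ ^ 2 + 1)) :=
        P.continuousOn₂.comp_continuous (by fun_prop) fun w => by
          simp only [mem_Ioi]; positivity
      have c3 : Continuous fun w : EuclideanSpace ℝ (Fin d) => (√(‖w‖ ^ 2 + 1) ^ (d + 2))⁻¹ := by
        refine Continuous.inv₀ (by fun_prop) fun w => ?_
        have : 0 < √(‖w‖ ^ 2 + 1) := Real.sqrt_pos.mpr (by positivity)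
        positivity
      refine Continuous.aestronglyMeasurable ?_
      have c1 : Continuous fun w : EuclideanSpace ℝ (Fin d) =>
          √(ε ^ 2 * (‖w‖ ^ 2 + 1)) ^ (d + 2) := by fun_prop
      exact ((continuous_const.mul ((Complex.continuous_ofReal.comp c1).mul c2)).mul
        (hφ.comp (by fun_prop))).mul (Complex.continuous_ofReal.comp c3)
    · have he1 : ∀ᶠ ε : ℝ in 𝓝[>] 0, ε ≤ 1 := nhdsWithin_le_nhds (Iic_mem_nhds one_pos)
      filter_upwards [self_mem_nhdsWithin, he1] with ε hε hε1
      have hε : 0 < ε := hε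
      refine Eventually.of_forall fun w => ?_
      have hB0 : 0 ≤ B := (norm_nonneg _).trans (hB 0)
      simp only [g, norm_mul, Complex.norm_real, norm_neg, Complex.norm_ofNat]
      rw [Real.norm_of_nonneg (by positivity), Real.norm_of_nonneg (by positivity)]
      refine mul_le_mul_of_nonneg_right ?_ (by positivity)
      by_cases hzs : ε • w ∈ tsupport φ
      · have hzR : ‖ε • w‖ ≤ R := by simpa using hR hzs
        have e1 : ε ^ 2 * (‖w‖ ^ 2 + 1) = ‖ε • w‖ ^ 2 + ε ^ 2 := by
          rw [norm_smul, Real.norm_of_nonneg hε.le]; ring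
        have hT : ε ^ 2 * (‖w‖ ^ 2 + 1) ≤ R ^ 2 + 1 := by
          rw [e1]
          have : ε ^ 2 ≤ 1 := pow_le_one₀ hε.le hε1
          gcongr
        have := (hC (ε ^ 2 * (‖w‖ ^ 2 + 1)) (by positivity) hT).2.2
        rw [mul_comm] at this
        have := hB (ε • w)
        gcongr
      · rw [image_eq_zero_of_notMem_tsupport hzs, norm_zero, mul_zero]
        positivity
    · refine Eventually.of_forall fun w => ?_
      have t1 : Tendsto (fun ε : ℝ => ε ^ 2 * (‖w‖ ^ 2 + 1)) (𝓝[>] 0) (𝓝[>] 0) := by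
        refine tendsto_nhdsWithin_iff.mpr ⟨?_, ?_⟩
        · have : Continuous fun ε : ℝ => ε ^ 2 * (‖w‖ ^ 2 + 1) := by fun_prop
          simpa using (this.tendsto 0).mono_left nhdsWithin_le_nhds
        · filter_upwards [self_mem_nhdsWithin] with ε hε
          have : 0 < ε := hε
          simp only [mem_Ioi]
          positivity
      have t2 : Tendsto (fun ε : ℝ => φ (ε • w)) (𝓝[>] 0) (𝓝 (φ ((0 : ℝ) • w))) := by
        have : Continuous fun ε : ℝ => φ (ε • w) := by fun_prop
        exact (this.tendsto 0).mono_left nhdsWithin_le_nhds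
      exact ((((P.lim₂ hd).comp t1).const_mul (-4)).mul t2).mul_const _
  -- The limit 1/(4V) from `lim₂`, the factor -4 and the mass V of the weight multiply to -1.
  have hval : ∫ w : EuclideanSpace ℝ (Fin d), (-4 * (1 / (4 * (V : ℂ))) * φ ((0 : ℝ) • w)) *
        (((√(‖w‖ ^ 2 + 1) ^ (d + 2))⁻¹ : ℝ) : ℂ) = -φ 0 := by
    simp only [zero_smul]
    rw [integral_const_mul, integral_complex_ofReal, hIV, ← hV]
    have : (V : ℂ) ≠ 0 := by exact_mod_cast hVpos.ne'
    field_simp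
  rw [hval] at hlim
  refine hlim.congr' ?_
  filter_upwards [self_mem_nhdsWithin] with ε hε
  exact (hscale ε hε).symm

/-- `z ↦ h (|z|²)` is a fundamental solution: `(Δ + k²) h(|z|²) = -δ₀`. -/
theorem integral_radial_mul_helmholtz (P : HelmholtzProfile d k h h1 h2) (hd : 0 < d)
    {φ : EuclideanSpace ℝ (Fin d) → ℂ} (hφ : ContDiff ℝ 2 φ) (hc : HasCompactSupport φ) :
    ∫ z, radial h 0 z * (Δ φ z + (k : ℂ) ^ 2 * φ z) = -φ 0 := by
  have l1 := (P.tendsto_integral_radial_mul hd (continuous_helmholtz hφ k)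
    (hasCompactSupport_helmholtz hc k)).comp tendsto_sq_nhdsGT
  refine tendsto_nhds_unique l1 ((P.tendsto_integral_regularized hd hφ.continuous hc).congr' ?_)
  filter_upwards [self_mem_nhdsWithin] with ε hε
  have hε : 0 < ε ^ 2 := by have : 0 < ε := hε; positivity
  rw [Function.comp_apply, integral_mul_helmholtz k hφ hc fun x _ =>
    (contDiff_radial (n := 2) P.contDiffOn hε).contDiffAt]
  refine integral_congr_ae (Eventually.of_forall fun z => ?_)
  simp only
  rw [laplacian_radial hε P.deriv₁ P.deriv₂, radial]
  -- The radial equation at s = |z|² + ε² has 4s h2(s), while the Laplacian has 4|z|² h2(s); only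
  -- -4ε² h2(s) survives.
  have := P.ode (‖z‖ ^ 2 + ε ^ 2) (by positivity)
  push_cast at this ⊢
  linear_combination (-φ z) * this

end HelmholtzProfile

end FundamentalSolution

/-! ### Differentiation and uniform convergence of convolution integrals. -/

section Convolution

variable {d : ℕ} {F : Type*} [NormedAddCommGroup F] [NormedSpace ℝ F] [NormedSpace ℂ F]
  {f : EuclideanSpace ℝ (Fin d) → ℂ} {K : EuclideanSpace ℝ (Fin d) → F}

lemma continuous_integral_smul [IsScalarTower ℝ ℂ F] (hf : Integrable f) (hK : Continuous K)
    (hc : HasCompactSupport K) : Continuous fun x => ∫ z, f (x - z) • K z := by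
  have h1 := hc.continuous_convolution_right (ContinuousLinearMap.lsmul ℝ ℂ (E := F))
    hf.locallyIntegrable hK (μ := volume)
  refine h1.congr fun x => ?_
  rw [convolution_def, ← integral_sub_left_eq_self _ volume x]
  simp

/-- As f is merely integrable, the derivative falls on the kernel. Keeping the translate on f is
what later allows f(x - z) to be compared with f(x). -/
lemma hasFDerivAt_integral_smul [IsScalarTower ℝ ℂ F] [SMulCommClass ℝ ℂ F]
    {K' : EuclideanSpace ℝ (Fin d) → EuclideanSpace ℝ (Fin d) →L[ℝ] F} (hf : Integrable f)
    (hK : ∀ z, HasFDerivAt K (K' z) z) (hK' : Continuous K') (hc : HasCompactSupport K)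
    (x : EuclideanSpace ℝ (Fin d)) :
    HasFDerivAt (fun x => ∫ z, f (x - z) • K z) (∫ z, f (x - z) • K' z) x := by
  have e : fderiv ℝ K = K' := funext fun z => (hK z).fderiv
  have hK1 : ContDiff ℝ 1 K := contDiff_one_iff_fderiv.mpr
    ⟨fun z => (hK z).differentiableAt, e ▸ hK'⟩
  have h1 := hc.hasFDerivAt_convolution_right (ContinuousLinearMap.lsmul ℝ ℂ (E := F))
    hf.locallyIntegrable hK1 x (μ := volume)
  have e1 : (fun x => ∫ z, f (x - z) • K z) =
      convolution f K (ContinuousLinearMap.lsmul ℝ ℂ (E := F)) volume := by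
    ext x
    rw [convolution_def, ← integral_sub_left_eq_self _ volume x]
    simp
  rw [e1]
  refine h1.congr_fderiv ?_
  rw [convolution_def, e, ← integral_sub_left_eq_self _ volume x]
  refine integral_congr_ae (Eventually.of_forall fun z => ?_)
  ext v
  simp [ContinuousLinearMap.precompR_apply]

/-- Integration by parts against the constant 1. Applied to the gradient of a regularised kernel, it
makes the integral of the Hessian vanish. -/
lemma integral_eq_zero_of_hasFDerivAt {F : Type*} [NormedAddCommGroup F] [NormedSpace ℝ F]
    [CompleteSpace F] {K : EuclideanSpace ℝ (Fin d) → F}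
    {K' : EuclideanSpace ℝ (Fin d) → EuclideanSpace ℝ (Fin d) →L[ℝ] F}
    (hK : ∀ z, HasFDerivAt K (K' z) z) (hK' : Continuous K') (hc : HasCompactSupport K) :
    ∫ z, K' z = 0 := by
  have e : fderiv ℝ K = K' := funext fun z => (hK z).fderiv
  have hc' : HasCompactSupport K' := e ▸ hc.fderiv (𝕜 := ℝ)
  have hKc : Continuous K := continuous_iff_continuousAt.mpr fun z => (hK z).continuousAt
  ext v
  rw [ContinuousLinearMap.integral_apply (hK'.integrable_of_hasCompactSupport hc')]
  have hcv : HasCompactSupport fun z => K' z v :=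
    hc'.comp_left (g := fun L : EuclideanSpace ℝ (Fin d) →L[ℝ] F => L v) (by simp)
  have := integral_bilinear_hasFDerivAt_right_eq_neg_left_of_integrable (μ := volume) (v := v)
    (B := ContinuousLinearMap.lsmul ℝ ℝ (E := F)) (f := fun _ => (1 : ℝ)) (f' := fun _ => 0)
    (g := K) (g' := K') (by simp)
    (by simpa using (hK'.clm_apply continuous_const).integrable_of_hasCompactSupport hcv)
    (by simpa using hKc.integrable_of_hasCompactSupport hc)
    (fun x _ => hasFDerivAt_const _ _) (fun x _ => hK x)
  simpa using this

/-- Convolution-type integrals against dominated, pointwise convergent kernels converge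
uniformly. -/
lemma tendstoUniformlyOn_integral_smul {ρ : ℝ} {κ : ℕ → EuclideanSpace ℝ (Fin d) → F}
    {w q : EuclideanSpace ℝ (Fin d) → ℝ} {s : Set (EuclideanSpace ℝ (Fin d))}
    {g : EuclideanSpace ℝ (Fin d) → EuclideanSpace ℝ (Fin d) → ℂ}
    (hm : ∀ n, AEStronglyMeasurable (κ n)) (hKm : AEStronglyMeasurable K)
    (hb : ∀ n, ∀ᵐ z, ‖κ n z‖ ≤ w z) (hKb : ∀ᵐ z, ‖K z‖ ≤ w z)
    (h0 : ∀ n z, ρ < ‖z‖ → κ n z = 0) (hK0 : ∀ z, ρ < ‖z‖ → K z = 0)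
    (hl : ∀ᵐ z, Tendsto (fun n => κ n z) atTop (𝓝 (K z)))
    (hg : ∀ x ∈ s, AEStronglyMeasurable (g x))
    (hgq : ∀ x ∈ s, ∀ z, ‖z‖ ≤ ρ → ‖g x z‖ ≤ q z)
    (hq : Continuous q) (hq0 : ∀ z, 0 ≤ q z)
    (hI : IntegrableOn (fun z => q z * w z) (Metric.closedBall 0 ρ)) :
    (∀ x ∈ s, Integrable fun z => g x z • K z) ∧
    TendstoUniformlyOn (fun n x => ∫ z, g x z • κ n z) (fun x => ∫ z, g x z • K z) atTop s := by
  have hI' : Integrable ((Metric.closedBall 0 ρ).indicator fun z => q z * w z) :=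
    hI.integrable_indicator measurableSet_closedBall
  have dom : ∀ k : EuclideanSpace ℝ (Fin d) → F, (∀ᵐ z, ‖k z‖ ≤ w z) →
      (∀ z, ρ < ‖z‖ → k z = 0) → ∀ x ∈ s, ∀ᵐ z, ‖g x z • k z‖ ≤
        (Metric.closedBall 0 ρ).indicator (fun z => q z * w z) z := by
    intro k hk hk0 x hx
    filter_upwards [hk] with z hz
    rcases le_or_gt ‖z‖ ρ with h | h
    · rw [indicator_of_mem (by simpa using h), norm_smul]
      have := hgq x hx z h
      have := hq0 z
      gcongr
    · rw [hk0 z h, smul_zero, norm_zero, indicator_of_notMem (by simpa using h)]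
  have int : ∀ k : EuclideanSpace ℝ (Fin d) → F, AEStronglyMeasurable k →
      (∀ᵐ z, ‖k z‖ ≤ w z) → (∀ z, ρ < ‖z‖ → k z = 0) → ∀ x ∈ s,
      Integrable fun z => g x z • k z := fun k hk1 hk2 hk3 x hx =>
    Integrable.mono' hI' ((hg x hx).smul hk1) (dom k hk2 hk3 x hx)
  refine ⟨int K hKm hKb hK0, ?_⟩
  have bnd : ∀ n, ∀ᵐ z, q z * ‖κ n z - K z‖ ≤
      2 * (Metric.closedBall 0 ρ).indicator (fun z => q z * w z) z := by
    intro n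
    filter_upwards [hb n, hKb] with z h1 h2
    rcases le_or_gt ‖z‖ ρ with h | h
    · rw [indicator_of_mem (by simpa using h)]
      calc q z * ‖κ n z - K z‖ ≤ q z * (w z + w z) := by
            have := hq0 z
            gcongr
            exact (norm_sub_le _ _).trans (add_le_add h1 h2)
        _ = _ := by ring
    · rw [h0 n z h, hK0 z h, indicator_of_notMem (by simpa using h)]
      simp
  have meas : ∀ n, AEStronglyMeasurable fun z => q z * ‖κ n z - K z‖ := fun n =>
    hq.aestronglyMeasurable.mul ((hm n).sub hKm).norm
  -- This integral does not involve x and bounds the error at every x in s, so its convergence to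
  -- zero gives uniform convergence.
  have hJ : Tendsto (fun n => ∫ z, q z * ‖κ n z - K z‖) atTop (𝓝 0) := by
    have := tendsto_integral_of_dominated_convergence _ meas (hI'.const_mul 2)
      (f := fun _ => (0 : ℝ))
      (fun n => by
        filter_upwards [bnd n] with z hz
        rwa [Real.norm_of_nonneg (mul_nonneg (hq0 z) (norm_nonneg _))])
      (by
        filter_upwards [hl] with z hz
        have h1 : Tendsto (fun n => κ n z - K z) atTop (𝓝 (K z - K z)) :=
          hz.sub tendsto_const_nhds
        simpa using h1.norm.const_mul (q z))
    simpa using this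
  have hJi : ∀ n, Integrable fun z => q z * ‖κ n z - K z‖ := fun n =>
    Integrable.mono' (hI'.const_mul 2) (meas n) (by
      filter_upwards [bnd n] with z hz
      rwa [Real.norm_of_nonneg (mul_nonneg (hq0 z) (norm_nonneg _))])
  rw [Metric.tendstoUniformlyOn_iff]
  intro ε hε
  filter_upwards [hJ.eventually (gt_mem_nhds hε)] with n hn x hx
  refine lt_of_le_of_lt ?_ hn
  rw [dist_comm, dist_eq_norm, ← integral_sub (int _ (hm n) (hb n) (h0 n) x hx)
    (int K hKm hKb hK0 x hx)]
  refine (norm_integral_le_integral_norm _).trans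
    (integral_mono_of_nonneg (Eventually.of_forall fun z => norm_nonneg _) (hJi n)
      (Eventually.of_forall fun z => ?_))
  simp only [← smul_sub, norm_smul]
  rcases le_or_gt ‖z‖ ρ with h | h
  · have := hgq x hx z h
    gcongr
  · simp [h0 n z h, hK0 z h]

end Convolution

/-! ### C² regularity of convolutions with a compactly supported singular kernel. -/

/-- A radial profile supported in `t ≤ ρ²` with a singularity of Newtonian type at `t = 0`. -/
structure SingularProfile (d : ℕ) (ρ C : ℝ) (H H1 H2 : ℝ → ℂ) : Prop where
  deriv₁ : ∀ t, 0 < t → HasDerivAt H (H1 t) t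
  deriv₂ : ∀ t, 0 < t → HasDerivAt H1 (H2 t) t
  cont₂ : ContinuousOn H2 (Ioi 0)
  zero₀ : ∀ t, ρ ^ 2 < t → H t = 0
  zero₁ : ∀ t, ρ ^ 2 < t → H1 t = 0
  zero₂ : ∀ t, ρ ^ 2 < t → H2 t = 0
  bound₀ : ∀ t, 0 < t → ‖H t‖ * √t ^ (d - 1) ≤ C
  bound₁ : ∀ t, 0 < t → ‖H1 t‖ * √t ^ d ≤ C
  bound₂ : ∀ t, 0 < t → ‖H2 t‖ * √t ^ (d + 2) ≤ C

namespace SingularProfile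

variable {d : ℕ} {ρ C : ℝ} {H H1 H2 : ℝ → ℂ} {δ : ℝ} {z : EuclideanSpace ℝ (Fin d)}

lemma cont₀ (S : SingularProfile d ρ C H H1 H2) : ContinuousOn H (Ioi 0) :=
  fun t ht => (S.deriv₁ t ht).continuousAt.continuousWithinAt

lemma cont₁ (S : SingularProfile d ρ C H H1 H2) : ContinuousOn H1 (Ioi 0) :=
  fun t ht => (S.deriv₂ t ht).continuousAt.continuousWithinAt

lemma radial_eq_zero (S : SingularProfile d ρ C H H1 H2) (hρ : 0 ≤ ρ) (hδ : 0 ≤ δ)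
    (hz : ρ < ‖z‖) : radial H δ z = 0 := S.zero₀ _ (by nlinarith)

lemma radialD_eq_zero (S : SingularProfile d ρ C H H1 H2) (hρ : 0 ≤ ρ) (hδ : 0 ≤ δ)
    (hz : ρ < ‖z‖) : radialD H1 δ z = 0 := by
  ext v
  simp [radialD, S.zero₁ (‖z‖ ^ 2 + δ) (by nlinarith)]

lemma radialDD_eq_zero (S : SingularProfile d ρ C H H1 H2) (hρ : 0 ≤ ρ) (hδ : 0 ≤ δ)
    (hz : ρ < ‖z‖) : radialDD H1 H2 δ z = 0 := by
  ext v w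
  simp [radialDD, S.zero₁ (‖z‖ ^ 2 + δ) (by nlinarith), S.zero₂ (‖z‖ ^ 2 + δ) (by nlinarith)]

/-- The factor 6 is generous here. It is the 2 + 4 of the Hessian bound, kept at all three orders.
-/
lemma norm_radial_le (S : SingularProfile d ρ C H H1 H2) (hδ : 0 ≤ δ) (hz : z ≠ 0) :
    ‖radial H δ z‖ ≤ 6 * C * ‖z‖ ^ (-(d - 1 : ℕ) : ℝ) := by
  have hz0 : 0 < ‖z‖ := norm_pos_iff.mpr hz
  have h1 := S.bound₀ (‖z‖ ^ 2 + δ) (by positivity)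
  have hC : 0 ≤ C := le_trans (by positivity) h1
  refine (le_mul_rpow_neg_of_mul_pow_le (norm_nonneg _) hz0 (norm_le_sqrt_add hδ) h1).trans ?_
  gcongr
  linarith

lemma norm_radialD_le (S : SingularProfile d ρ C H H1 H2) (hd : 0 < d) (hδ : 0 ≤ δ) (hz : z ≠ 0) :
    ‖radialD H1 δ z‖ ≤ 6 * C * ‖z‖ ^ (-(d - 1 : ℕ) : ℝ) := by
  have hz0 : 0 < ‖z‖ := norm_pos_iff.mpr hz
  have h1 := S.bound₁ (‖z‖ ^ 2 + δ) (by positivity)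
  have hC : 0 ≤ C := le_trans (by positivity) h1
  have h2 := le_mul_rpow_neg_of_mul_pow_le (norm_nonneg _) hz0 (norm_le_sqrt_add hδ) h1
  have e : ‖z‖ ^ (-(d - 1 : ℕ) : ℝ) = ‖z‖ * ‖z‖ ^ (-d : ℝ) := by
    nth_rewrite 2 [← Real.rpow_one ‖z‖]
    rw [← Real.rpow_add hz0, Nat.cast_sub (by omega)]
    congr 1; push_cast; ring
  calc ‖radialD H1 δ z‖ ≤ 2 * ‖z‖ * ‖H1 (‖z‖ ^ 2 + δ)‖ := InverseScattering.norm_radialD_le _ _ _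
    _ ≤ 6 * ‖z‖ * (C * ‖z‖ ^ (-d : ℝ)) := by gcongr; norm_num
    _ = _ := by rw [e]; ring

/-- Both Hessian terms scale like |z|^{-d}, the critical power that is not integrable at the origin;
a gain from the density is therefore required. -/
lemma norm_radialDD_le (S : SingularProfile d ρ C H H1 H2) (hδ : 0 ≤ δ) (hz : z ≠ 0) :
    ‖radialDD H1 H2 δ z‖ ≤ 6 * C * ‖z‖ ^ (-d : ℝ) := by
  have hz0 : 0 < ‖z‖ := norm_pos_iff.mpr hz
  have h1 := le_mul_rpow_neg_of_mul_pow_le (norm_nonneg _) hz0 (norm_le_sqrt_add hδ)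
    (S.bound₁ (‖z‖ ^ 2 + δ) (by positivity))
  have h2 := le_mul_rpow_neg_of_mul_pow_le (norm_nonneg _) hz0 (norm_le_sqrt_add hδ)
    (S.bound₂ (‖z‖ ^ 2 + δ) (by positivity))
  have e : ‖z‖ ^ 2 * ‖z‖ ^ (-(d + 2 : ℕ) : ℝ) = ‖z‖ ^ (-d : ℝ) := by
    rw [← Real.rpow_natCast, ← Real.rpow_add hz0]
    congr 1; push_cast; ring
  calc ‖radialDD H1 H2 δ z‖
      ≤ 2 * ‖H1 (‖z‖ ^ 2 + δ)‖ + 4 * ‖z‖ ^ 2 * ‖H2 (‖z‖ ^ 2 + δ)‖ :=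
        InverseScattering.norm_radialDD_le _ _ _ _
    _ ≤ 2 * (C * ‖z‖ ^ (-d : ℝ)) + 4 * ‖z‖ ^ 2 * (C * ‖z‖ ^ (-(d + 2 : ℕ) : ℝ)) := by gcongr
    _ = 2 * (C * ‖z‖ ^ (-d : ℝ)) + 4 * C * (‖z‖ ^ 2 * ‖z‖ ^ (-(d + 2 : ℕ) : ℝ)) := by ring
    _ = _ := by rw [e]; ring

lemma continuousOn_radialD (S : SingularProfile d ρ C H H1 H2) (hδ : 0 ≤ δ) :
    ContinuousOn (radialD H1 δ : EuclideanSpace ℝ (Fin d) → _) {0}ᶜ :=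
  (continuousOn_const.mul (continuousOn_radial S.cont₁ hδ)).smul (innerC d).continuous.continuousOn

lemma continuous_innerC_smulRight :
    Continuous fun z : EuclideanSpace ℝ (Fin d) => (innerC d z).smulRight (innerC d z) := by
  refine continuous_clm_apply.mpr fun v => continuous_clm_apply.mpr fun w => ?_
  simp only [ContinuousLinearMap.smulRight_apply, smul_apply, innerC_apply]
  fun_prop

set_option maxSynthPendingDepth 3 in
lemma continuousOn_radialDD (S : SingularProfile d ρ C H H1 H2) (hδ : 0 ≤ δ) :
    ContinuousOn (radialDD H1 H2 δ : EuclideanSpace ℝ (Fin d) → _) {0}ᶜ := by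
  refine ((continuousOn_const.mul (continuousOn_radial S.cont₁ hδ)).smul continuousOn_const).add
    ((continuousOn_const.mul (continuousOn_radial S.cont₂ hδ)).smul ?_)
  exact continuous_innerC_smulRight.continuousOn

lemma continuous_radial_comp {G : ℝ → ℂ} (hG : ContinuousOn G (Ioi 0)) (hδ : 0 < δ) :
    Continuous (radial G δ : EuclideanSpace ℝ (Fin d) → ℂ) :=
  hG.comp_continuous (f := fun z : EuclideanSpace ℝ (Fin d) => ‖z‖ ^ 2 + δ) (by fun_prop)
    fun z => by simp only [mem_Ioi]; positivity

set_option maxSynthPendingDepth 3 in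
lemma continuous_radialDD (S : SingularProfile d ρ C H H1 H2) (hδ : 0 < δ) :
    Continuous (radialDD H1 H2 δ : EuclideanSpace ℝ (Fin d) → _) := by
  refine ((continuous_const.mul (continuous_radial_comp S.cont₁ hδ)).smul continuous_const).add
    ((continuous_const.mul (continuous_radial_comp S.cont₂ hδ)).smul ?_)
  exact continuous_innerC_smulRight

lemma continuous_radialD (S : SingularProfile d ρ C H H1 H2) (hδ : 0 < δ) :
    Continuous (radialD H1 δ : EuclideanSpace ℝ (Fin d) → _) :=
  (continuous_const.mul (continuous_radial_comp S.cont₁ hδ)).smul (innerC d).continuous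

lemma tendsto_radialD_zero (S : SingularProfile d ρ C H H1 H2) (hz : z ≠ 0) :
    Tendsto (fun δ => radialD H1 δ z) (𝓝 0) (𝓝 (radialD H1 0 z)) :=
  ((tendsto_radial_zero S.cont₁ hz).const_mul 2).smul_const _

set_option maxSynthPendingDepth 3 in
lemma tendsto_radialDD_zero (S : SingularProfile d ρ C H H1 H2) (hz : z ≠ 0) :
    Tendsto (fun δ => radialDD H1 H2 δ z) (𝓝 0) (𝓝 (radialDD H1 H2 0 z)) :=
  (((tendsto_radial_zero S.cont₁ hz).const_mul 2).smul_const _).add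
    (((tendsto_radial_zero S.cont₂ hz).const_mul 4).smul_const _)

set_option maxSynthPendingDepth 3 in
/-- Local Hölder regularity for convolutions with a singular radial kernel. -/
theorem contDiffOn_integral (S : SingularProfile d ρ C H H1 H2) (hd : 0 < d) (hρ : 0 < ρ)
    {f : EuclideanSpace ℝ (Fin d) → ℂ} (hf : Integrable f) {x₀ : EuclideanSpace ℝ (Fin d)}
    {B M α : ℝ} (hα : 0 < α) (hB0 : 0 ≤ B) (hM0 : 0 ≤ M)
    (hB : ∀ x ∈ Metric.ball x₀ ρ, ∀ z, ‖z‖ ≤ ρ → ‖f (x - z)‖ ≤ B)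
    (hM : ∀ x ∈ Metric.ball x₀ ρ, ∀ z, ‖z‖ ≤ ρ → ‖f (x - z) - f x‖ ≤ M * ‖z‖ ^ α) :
    (∀ x ∈ Metric.ball x₀ ρ, Integrable fun z => f (x - z) * radial H 0 z) ∧
    ContDiffOn ℝ 2 (fun x => ∫ z, f (x - z) * radial H 0 z) (Metric.ball x₀ ρ) := by
  set δ : ℕ → ℝ := fun n => 1 / ((n : ℝ) + 1) with hδ
  have δpos : ∀ n, 0 < δ n := fun n => by positivity
  have δlim : Tendsto δ atTop (𝓝 0) := tendsto_one_div_add_atTop_nhds_zero_nat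
  have hfm : ∀ x, AEStronglyMeasurable fun z => f (x - z) := fun x =>
    (hf.comp_sub_left x).aestronglyMeasurable
  have hIB : IntegrableOn (fun z : EuclideanSpace ℝ (Fin d) =>
      B * (6 * C * ‖z‖ ^ (-(d - 1 : ℕ) : ℝ))) (Metric.closedBall 0 ρ) :=
    ((integrableOn_norm_pow hd (HelmholtzProfile.exponent_lt hd)).const_mul _).const_mul _
  -- The Hölder gain |z|^α raises the critical exponent to α - d > -d.
  have hIM : IntegrableOn (fun z : EuclideanSpace ℝ (Fin d) =>
      M * ‖z‖ ^ α * (6 * C * ‖z‖ ^ (-d : ℝ))) (Metric.closedBall 0 ρ) := by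
    refine ((integrableOn_norm_pow hd (a := α - d) (by linarith)).const_mul (M * (6 * C))).congr ?_
    filter_upwards [ae_restrict_of_ae (ae_ne_zero hd)] with z hz
    rw [sub_eq_add_neg, Real.rpow_add (norm_pos_iff.mpr hz)]
    ring
  obtain ⟨i0, u0⟩ := tendstoUniformlyOn_integral_smul (ρ := ρ)
    (κ := fun n => radial H (δ n)) (K := (radial H 0 : EuclideanSpace ℝ (Fin d) → ℂ))
    (s := Metric.ball x₀ ρ) (g := fun x z => f (x - z))
    (w := fun z => 6 * C * ‖z‖ ^ (-(d - 1 : ℕ) : ℝ)) (q := fun _ => B)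
    (fun n => (continuous_radial_comp S.cont₀ (δpos n)).aestronglyMeasurable)
    (aestronglyMeasurable_of_continuousOn_compl_zero hd (continuousOn_radial S.cont₀ le_rfl))
    (fun n => (ae_ne_zero hd).mono fun z hz => S.norm_radial_le (δpos n).le hz)
    ((ae_ne_zero hd).mono fun z hz => S.norm_radial_le le_rfl hz)
    (fun n z hz => S.radial_eq_zero hρ.le (δpos n).le hz)
    (fun z hz => S.radial_eq_zero hρ.le le_rfl hz)
    ((ae_ne_zero hd).mono fun z hz => (tendsto_radial_zero S.cont₀ hz).comp δlim)
    (fun x _ => hfm x) hB continuous_const (fun _ => hB0) hIB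
  obtain ⟨i1, u1⟩ := tendstoUniformlyOn_integral_smul (ρ := ρ)
    (κ := fun n => radialD H1 (δ n)) (K := (radialD H1 0 : EuclideanSpace ℝ (Fin d) → _))
    (s := Metric.ball x₀ ρ) (g := fun x z => f (x - z))
    (w := fun z => 6 * C * ‖z‖ ^ (-(d - 1 : ℕ) : ℝ)) (q := fun _ => B)
    (fun n => (S.continuous_radialD (δpos n)).aestronglyMeasurable)
    (aestronglyMeasurable_of_continuousOn_compl_zero hd (S.continuousOn_radialD le_rfl))
    (fun n => (ae_ne_zero hd).mono fun z hz => S.norm_radialD_le hd (δpos n).le hz)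
    ((ae_ne_zero hd).mono fun z hz => S.norm_radialD_le hd le_rfl hz)
    (fun n z hz => S.radialD_eq_zero hρ.le (δpos n).le hz)
    (fun z hz => S.radialD_eq_zero hρ.le le_rfl hz)
    ((ae_ne_zero hd).mono fun z hz => (S.tendsto_radialD_zero hz).comp δlim)
    (fun x _ => hfm x) hB continuous_const (fun _ => hB0) hIB
  -- At second order the density is replaced by its increment f(x - z) - f(x); the two lower orders
  -- need only boundedness of f.
  obtain ⟨i2, u2⟩ := tendstoUniformlyOn_integral_smul (ρ := ρ)
    (κ := fun n => radialDD H1 H2 (δ n)) (K := (radialDD H1 H2 0 : EuclideanSpace ℝ (Fin d) → _))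
    (s := Metric.ball x₀ ρ) (g := fun x z => f (x - z) - f x)
    (w := fun z => 6 * C * ‖z‖ ^ (-d : ℝ)) (q := fun z => M * ‖z‖ ^ α)
    (fun n => (S.continuous_radialDD (δpos n)).aestronglyMeasurable)
    (aestronglyMeasurable_of_continuousOn_compl_zero hd (S.continuousOn_radialDD le_rfl))
    (fun n => (ae_ne_zero hd).mono fun z hz => S.norm_radialDD_le (δpos n).le hz)
    ((ae_ne_zero hd).mono fun z hz => S.norm_radialDD_le le_rfl hz)
    (fun n z hz => S.radialDD_eq_zero hρ.le (δpos n).le hz)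
    (fun z hz => S.radialDD_eq_zero hρ.le le_rfl hz)
    ((ae_ne_zero hd).mono fun z hz => (S.tendsto_radialDD_zero hz).comp δlim)
    (fun x _ => (hfm x).sub aestronglyMeasurable_const) hM
    (continuous_const.mul (continuous_norm.rpow_const fun _ => Or.inr hα.le))
    (fun z => by positivity) hIM
  have c0 : ∀ n, HasCompactSupport (radial H (δ n) : EuclideanSpace ℝ (Fin d) → ℂ) := fun n =>
    HasCompactSupport.intro (isCompact_closedBall 0 ρ) fun z hz =>
      S.radial_eq_zero hρ.le (δpos n).le (by simpa using hz)
  have c1 : ∀ n, HasCompactSupport (radialD H1 (δ n) : EuclideanSpace ℝ (Fin d) → _) := fun n =>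
    HasCompactSupport.intro (isCompact_closedBall 0 ρ) fun z hz =>
      S.radialD_eq_zero hρ.le (δpos n).le (by simpa using hz)
  have c2 : ∀ n, HasCompactSupport (radialDD H1 H2 (δ n) : EuclideanSpace ℝ (Fin d) → _) := fun n =>
    HasCompactSupport.intro (isCompact_closedBall 0 ρ) fun z hz =>
      S.radialDD_eq_zero hρ.le (δpos n).le (by simpa using hz)
  have d0 : ∀ n (z : EuclideanSpace ℝ (Fin d)),
      HasFDerivAt (radial H (δ n)) (radialD H1 (δ n) z) z := fun n z =>
    hasFDerivAt_radial (S.deriv₁ _ (by have := δpos n; positivity))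
  have d1 : ∀ n (z : EuclideanSpace ℝ (Fin d)),
      HasFDerivAt (radialD H1 (δ n)) (radialDD H1 H2 (δ n) z) z := fun n z =>
    hasFDerivAt_radialD (S.deriv₂ _ (by have := δpos n; positivity))
  -- For δ > 0 the Hessian has integral zero, so subtracting f(x) changes nothing. In the limit the
  -- subtracted form has to be kept, since the limiting Hessian bound is not integrable.
  have e2 : ∀ n x, ∫ z, (f (x - z) - f x) • radialDD H1 H2 (δ n) z =
      ∫ z, f (x - z) • radialDD H1 H2 (δ n) z := by
    intro n x
    have hb := (S.continuous_radialDD (d := d) (δpos n)).bounded_above_of_compact_support (c2 n)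
    obtain ⟨b, hb⟩ := hb
    have hi1 : Integrable fun z => f (x - z) • radialDD H1 H2 (δ n) z :=
      (hf.comp_sub_left x).smul_bdd b
        (S.continuous_radialDD (δpos n)).aestronglyMeasurable (Eventually.of_forall hb)
    have hi2 : Integrable fun z => f x • radialDD H1 H2 (δ n) z :=
      ((S.continuous_radialDD (δpos n)).integrable_of_hasCompactSupport (c2 n)).smul (f x)
    simp only [sub_smul]
    rw [integral_sub hi1 hi2, integral_smul,
      integral_eq_zero_of_hasFDerivAt (d1 n) (S.continuous_radialDD (δpos n)) (c1 n), smul_zero,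
      sub_zero]
  simp only [e2] at u2
  -- A pointwise limit of functions whose derivatives converge uniformly is differentiable, with the
  -- limit derivative; used for the potential and again for its gradient.
  have D0 : ∀ x ∈ Metric.ball x₀ ρ, HasFDerivAt (fun x => ∫ z, f (x - z) • radial H 0 z)
      (∫ z, f (x - z) • radialD H1 0 z) x := fun x hx =>
    hasFDerivAt_of_tendstoUniformlyOn Metric.isOpen_ball u1
      (fun n x _ => hasFDerivAt_integral_smul hf (d0 n) (S.continuous_radialD (δpos n)) (c0 n) x)
      (fun x hx => u0.tendsto_at hx) hx
  have D1 : ∀ x ∈ Metric.ball x₀ ρ, HasFDerivAt (fun x => ∫ z, f (x - z) • radialD H1 0 z)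
      (∫ z, (f (x - z) - f x) • radialDD H1 H2 0 z) x := fun x hx =>
    hasFDerivAt_of_tendstoUniformlyOn Metric.isOpen_ball u2
      (fun n x _ => hasFDerivAt_integral_smul hf (d1 n) (S.continuous_radialDD (δpos n)) (c1 n) x)
      (fun x hx => u1.tendsto_at hx) hx
  have C2 : ContinuousOn (fun x => ∫ z, (f (x - z) - f x) • radialDD H1 H2 0 z)
      (Metric.ball x₀ ρ) :=
    u2.continuousOn (Frequently.of_forall fun n =>
      (continuous_integral_smul hf (S.continuous_radialDD (δpos n)) (c2 n)).continuousOn)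
  refine ⟨i0, ?_⟩
  have two : (2 : WithTop ℕ∞) = 1 + 1 := by norm_num
  have one : (1 : WithTop ℕ∞) = 0 + 1 := by simp
  have s1 : ContDiffOn ℝ 1 (fun x => ∫ z, f (x - z) • radialD H1 0 z) (Metric.ball x₀ ρ) := by
    rw [one, contDiffOn_succ_iff_fderiv_of_isOpen Metric.isOpen_ball]
    refine ⟨fun x hx => (D1 x hx).differentiableAt.differentiableWithinAt, by simp, ?_⟩
    rw [contDiffOn_zero]
    exact C2.congr fun x hx => (D1 x hx).fderiv
  rw [two, contDiffOn_succ_iff_fderiv_of_isOpen Metric.isOpen_ball]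
  exact ⟨fun x hx => (D0 x hx).differentiableAt.differentiableWithinAt, by simp,
    s1.congr fun x hx => (D0 x hx).fderiv⟩

end SingularProfile

/-! ### A smooth cutoff and its first two derivatives. -/

section Cutoff

/-- A smooth cutoff which is `1` for `t ≤ T / 2` and `0` for `t ≥ T`. -/
def cutoff (T t : ℝ) : ℝ := Real.smoothTransition (2 - 2 * t / T)

variable {T t : ℝ}

lemma contDiff_cutoff (T : ℝ) {n : ℕ∞} : ContDiff ℝ n (cutoff T) :=
  Real.smoothTransition.contDiff.comp (by fun_prop)

lemma cutoff_eq_one (hT : 0 < T) (ht : t ≤ T / 2) : cutoff T t = 1 := by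
  refine Real.smoothTransition.one_of_one_le ?_
  have : 2 * t / T ≤ 1 := by rw [div_le_one hT]; linarith
  linarith

lemma cutoff_eq_zero (hT : 0 < T) (ht : T ≤ t) : cutoff T t = 0 := by
  refine Real.smoothTransition.zero_of_nonpos ?_
  have : 2 ≤ 2 * t / T := by rw [le_div_iff₀ hT]; linarith
  linarith

lemma deriv_cutoff_eventuallyEq (hT : 0 < T) (ht : T < t) : deriv (cutoff T) =ᶠ[𝓝 t] fun _ => 0 := by
  have h1 : cutoff T =ᶠ[𝓝 t] fun _ => 0 := by
    filter_upwards [Ioi_mem_nhds ht] with s hs using cutoff_eq_zero hT (le_of_lt hs)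
  simpa using h1.deriv

lemma hasDerivAt_cutoff (T t : ℝ) : HasDerivAt (fun t => (cutoff T t : ℂ))
    ((deriv (cutoff T) t : ℝ) : ℂ) t :=
  (((contDiff_cutoff T (n := 1)).differentiable (by simp)) t).hasDerivAt.ofReal_comp

lemma contDiff_deriv_cutoff (T : ℝ) : ContDiff ℝ 1 (deriv (cutoff T)) := by
  have h := contDiff_cutoff T (n := 2)
  rw [show ((2 : ℕ∞) : WithTop ℕ∞) = 1 + 1 by norm_num] at h
  exact (contDiff_succ_iff_deriv.mp h).2.2

lemma hasDerivAt_deriv_cutoff (T t : ℝ) : HasDerivAt (fun t => ((deriv (cutoff T) t : ℝ) : ℂ))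
    ((deriv (deriv (cutoff T)) t : ℝ) : ℂ) t :=
  ((contDiff_deriv_cutoff T).differentiable (by simp) t).hasDerivAt.ofReal_comp

lemma continuous_deriv_deriv_cutoff (T : ℝ) : Continuous (deriv (deriv (cutoff T))) :=
  (contDiff_deriv_cutoff T).continuous_deriv (by simp)

end Cutoff

/-! ### Near–far splitting of the fundamental solution. -/

namespace HelmholtzProfile

variable {d : ℕ} {k : ℝ} {h h1 h2 : ℝ → ℂ}

/-- The singular part of a fundamental solution, cut off at distance `ρ`. -/
lemma exists_singularProfile (P : HelmholtzProfile d k h h1 h2) (hd : 0 < d) {ρ : ℝ} (hρ : 0 < ρ) :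
    ∃ C H1 H2, SingularProfile d ρ C (fun t => h t * (cutoff (ρ ^ 2) t : ℂ)) H1 H2 := by
  set T := ρ ^ 2 with hT
  have hTpos : 0 < T := by positivity
  set θ : ℝ → ℂ := fun t => (cutoff T t : ℂ)
  set θ1 : ℝ → ℂ := fun t => ((deriv (cutoff T) t : ℝ) : ℂ)
  set θ2 : ℝ → ℂ := fun t => ((deriv (deriv (cutoff T)) t : ℝ) : ℂ)
  have cθ : Continuous θ :=
    Complex.continuous_ofReal.comp (contDiff_cutoff T (n := 1)).continuous
  have cθ1 : Continuous θ1 := Complex.continuous_ofReal.comp (contDiff_deriv_cutoff T).continuous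
  have cθ2 : Continuous θ2 := Complex.continuous_ofReal.comp (continuous_deriv_deriv_cutoff T)
  obtain ⟨D0, hD0⟩ := (isCompact_Icc (a := 0) (b := T)).exists_bound_of_continuousOn cθ.continuousOn
  obtain ⟨D1, hD1⟩ :=
    (isCompact_Icc (a := 0) (b := T)).exists_bound_of_continuousOn cθ1.continuousOn
  obtain ⟨D2, hD2⟩ :=
    (isCompact_Icc (a := 0) (b := T)).exists_bound_of_continuousOn cθ2.continuousOn
  have mem0 : (0 : ℝ) ∈ Icc 0 T := ⟨le_rfl, hTpos.le⟩
  have hD0' : 0 ≤ D0 := (norm_nonneg _).trans (hD0 0 mem0)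
  have hD1' : 0 ≤ D1 := (norm_nonneg _).trans (hD1 0 mem0)
  have hD2' : 0 ≤ D2 := (norm_nonneg _).trans (hD2 0 mem0)
  obtain ⟨C, hC, hb⟩ := P.exists_bound hd T
  have z0 : ∀ t, T < t → θ t = 0 := fun t ht => by simp [θ, cutoff_eq_zero hTpos ht.le]
  have z1 : ∀ t, T < t → θ1 t = 0 := fun t ht => by
    simp [θ1, (deriv_cutoff_eventuallyEq hTpos ht).eq_of_nhds]
  have z2 : ∀ t, T < t → θ2 t = 0 := fun t ht => by
    simp [θ2, (deriv_cutoff_eventuallyEq hTpos ht).deriv_eq]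
  -- The sum of the bounds needed for the kernel and its two derivatives. The powers of ρ come from
  -- spare factors √t ≤ ρ, wherever a derivative falls on the cutoff and not on h.
  refine ⟨C * D0 + (2 * C * D0 + C * D1 * ρ) + (C * D0 + 2 * C * D1 * ρ ^ 2 + C * D2 * ρ ^ 3),
    fun t => h1 t * θ t + h t * θ1 t, fun t => h2 t * θ t + 2 * (h1 t * θ1 t) + h t * θ2 t,
    ?_, ?_, ?_, ?_, ?_, ?_, ?_, ?_, ?_⟩
  · exact fun t ht => (P.deriv₁ t ht).mul (hasDerivAt_cutoff T t)
  · intro t ht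
    refine (((P.deriv₂ t ht).mul (hasDerivAt_cutoff T t)).add
      ((P.deriv₁ t ht).mul (hasDerivAt_deriv_cutoff T t))).congr_deriv ?_
    simp only [θ, θ1, θ2]
    ring
  · exact ((P.continuousOn₂.mul cθ.continuousOn).add (continuousOn_const.mul
      (P.continuousOn₁.mul cθ1.continuousOn))).add (P.continuousOn₀.mul cθ2.continuousOn)
  · intro t ht
    exact mul_eq_zero_of_right _ (z0 t ht)
  · intro t ht
    simp [z0 t ht, z1 t ht]
  · intro t ht
    simp [z0 t ht, z1 t ht, z2 t ht]
  all_goals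
    intro t ht
    have q0 : 0 ≤ C * D0 := by positivity
    have q1 : 0 ≤ C * D1 * ρ := by positivity
    have q2 : 0 ≤ C * D1 * ρ ^ 2 := by positivity
    have q3 : 0 ≤ C * D2 * ρ ^ 3 := by positivity
    rcases lt_or_ge T t with hTt | hTt
    · simp only [z0 t hTt, z1 t hTt, z2 t hTt, mul_zero, add_zero, norm_zero, zero_mul,
        show (cutoff T t : ℂ) = 0 from z0 t hTt]
      positivity
    have hm : t ∈ Icc 0 T := ⟨ht.le, hTt⟩
    obtain ⟨b0, b1, b2⟩ := hb t ht hTt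
    have hs : √t ≤ ρ := by rw [Real.sqrt_le_left hρ.le]; exact hTt
    have e1 : √t ^ d = √t ^ (d - 1) * √t := by rw [← pow_succ, Nat.sub_add_cancel hd]
    have n0 := hD0 t hm
    have n1 := hD1 t hm
    have n2 := hD2 t hm
    have p0 : ‖h t * θ t‖ * √t ^ (d - 1) ≤ C * D0 := by
      rw [norm_mul, mul_right_comm]; gcongr
    have p1 : ‖h1 t * θ t‖ * √t ^ d ≤ C * D0 := by
      rw [norm_mul, mul_right_comm]; gcongr
    have p2 : ‖h2 t * θ t‖ * √t ^ (d + 2) ≤ C * D0 := by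
      rw [norm_mul, mul_right_comm]; gcongr
  · exact p0.trans (by linarith)
  · have q : ‖h t * θ1 t‖ * √t ^ d ≤ C * D1 * ρ := by
      calc ‖h t * θ1 t‖ * √t ^ d = (‖h t‖ * √t ^ (d - 1)) * ‖θ1 t‖ * √t := by
            rw [norm_mul, e1]; ring
        _ ≤ _ := by gcongr
    have := norm_add_le (h1 t * θ t) (h t * θ1 t)
    calc ‖h1 t * θ t + h t * θ1 t‖ * √t ^ d
        ≤ (‖h1 t * θ t‖ + ‖h t * θ1 t‖) * √t ^ d := by gcongr
      _ = ‖h1 t * θ t‖ * √t ^ d + ‖h t * θ1 t‖ * √t ^ d := by ring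
      _ ≤ C * D0 + C * D1 * ρ := add_le_add p1 q
      _ ≤ _ := by linarith
  · have q1 : ‖2 * (h1 t * θ1 t)‖ * √t ^ (d + 2) ≤ 2 * C * D1 * ρ ^ 2 := by
      calc ‖2 * (h1 t * θ1 t)‖ * √t ^ (d + 2) = 2 * (‖h1 t‖ * √t ^ d) * ‖θ1 t‖ * √t ^ 2 := by
            rw [norm_mul, norm_mul, Complex.norm_ofNat]; ring
        _ ≤ _ := by gcongr
    have q2 : ‖h t * θ2 t‖ * √t ^ (d + 2) ≤ C * D2 * ρ ^ 3 := by
      calc ‖h t * θ2 t‖ * √t ^ (d + 2) = (‖h t‖ * √t ^ (d - 1)) * ‖θ2 t‖ * √t ^ 3 := by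
            rw [norm_mul, pow_add, e1]; ring
        _ ≤ _ := by gcongr
    have := norm_add₃_le (a := h2 t * θ t) (b := 2 * (h1 t * θ1 t)) (c := h t * θ2 t)
    calc ‖h2 t * θ t + 2 * (h1 t * θ1 t) + h t * θ2 t‖ * √t ^ (d + 2)
        ≤ (‖h2 t * θ t‖ + ‖2 * (h1 t * θ1 t)‖ + ‖h t * θ2 t‖) * √t ^ (d + 2) := by gcongr
      _ = ‖h2 t * θ t‖ * √t ^ (d + 2) + ‖2 * (h1 t * θ1 t)‖ * √t ^ (d + 2) +
          ‖h t * θ2 t‖ * √t ^ (d + 2) := by ring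
      _ ≤ C * D0 + 2 * C * D1 * ρ ^ 2 + C * D2 * ρ ^ 3 := add_le_add (add_le_add p2 q1) q2
      _ ≤ _ := by linarith

/-- The regular part of a fundamental solution, cut off at infinity. -/
lemma contDiff_far (P : HelmholtzProfile d k h h1 h2) {T R : ℝ} (hT : 0 < T) :
    ContDiff ℝ 2 fun t => h t * (1 - (cutoff T t : ℂ)) * (cutoff R t : ℂ) := by
  have hθ : ∀ S, ContDiff ℝ 2 fun t => (cutoff S t : ℂ) := fun S =>
    Complex.ofRealCLM.contDiff.comp (contDiff_cutoff S (n := 2))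
  rw [contDiff_iff_contDiffAt]
  intro t
  rcases lt_or_ge t (T / 2) with ht | ht
  · refine (contDiffAt_const (c := (0 : ℂ))).congr_of_eventuallyEq ?_
    filter_upwards [Iio_mem_nhds ht] with s hs
    simp [cutoff_eq_one hT (le_of_lt hs)]
  · have ht0 : 0 < t := by linarith
    exact ((P.contDiffOn.contDiffAt (Ioi_mem_nhds ht0)).mul
      (contDiffAt_const.sub (hθ T).contDiffAt)).mul (hθ R).contDiffAt

/-- The singular part is handled by the Hölder theorem. The far part is a C² compactly supported
kernel, so its convolution with an integrable density is C² with no regularity of f. -/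
theorem contDiffAt_potential (P : HelmholtzProfile d k h h1 h2) (hd : 0 < d)
    {f : EuclideanSpace ℝ (Fin d) → ℂ} (hf : Integrable f) {R₀ : ℝ}
    (hf0 : ∀ y, R₀ < ‖y‖ → f y = 0) {x₀ : EuclideanSpace ℝ (Fin d)}
    {ρ B M α : ℝ} (hρ : 0 < ρ) (hα : 0 < α) (hB0 : 0 ≤ B) (hM0 : 0 ≤ M)
    (hB : ∀ x ∈ Metric.ball x₀ ρ, ∀ z, ‖z‖ ≤ ρ → ‖f (x - z)‖ ≤ B)
    (hM : ∀ x ∈ Metric.ball x₀ ρ, ∀ z, ‖z‖ ≤ ρ → ‖f (x - z) - f x‖ ≤ M * ‖z‖ ^ α) :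
    Integrable (fun y => f y * radial h 0 (x₀ - y)) ∧
      ContDiffAt ℝ 2 (fun x => ∫ y, f y * radial h 0 (x - y)) x₀ := by
  obtain ⟨C, H1, H2, S⟩ := P.exists_singularProfile hd hρ
  obtain ⟨i1, c1⟩ := S.contDiffOn_integral hd hρ hf hα hB0 hM0 hB hM
  have hTpos : 0 < ρ ^ 2 := by positivity
  -- If x is within ρ of x₀ and f(x - z) ≠ 0, then |z| ≤ ‖x₀‖ + ρ + R₀, so |z|² ≤ R/2 and the outer
  -- cutoff equals 1. The added 1 keeps R positive.
  set R := 2 * (‖x₀‖ + ρ + R₀) ^ 2 + 1 with hR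
  have hRpos : 0 < R := by positivity
  set Hs : ℝ → ℂ := fun t => h t * (cutoff (ρ ^ 2) t : ℂ) with hHs
  set Hf : ℝ → ℂ := fun t => h t * (1 - (cutoff (ρ ^ 2) t : ℂ)) * (cutoff R t : ℂ) with hHf
  have cN : ContDiff ℝ 2 (radial Hf 0 : EuclideanSpace ℝ (Fin d) → ℂ) :=
    (P.contDiff_far hTpos).comp ((contDiff_norm_sq ℝ).add contDiff_const)
  have sN : HasCompactSupport (radial Hf 0 : EuclideanSpace ℝ (Fin d) → ℂ) := by
    refine HasCompactSupport.intro (isCompact_closedBall 0 √R) fun z hz => ?_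
    have : R ≤ ‖z‖ ^ 2 + 0 := by
      rw [add_zero]
      have hz' : √R < ‖z‖ := by simpa using hz
      exact (Real.sqrt_le_left (norm_nonneg z)).mp hz'.le
    simp only [radial, Hf, cutoff_eq_zero hRpos this, Complex.ofReal_zero, mul_zero]
  have split : ∀ x ∈ Metric.ball x₀ ρ, ∀ z, f (x - z) * radial h 0 z =
      f (x - z) * radial Hs 0 z + f (x - z) * radial Hf 0 z := by
    intro x hx z
    by_cases hz : R₀ < ‖x - z‖
    · simp [hf0 _ hz]
    have hzn : ‖z‖ ≤ ‖x₀‖ + ρ + R₀ := by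
      have h1 : ‖x - x₀‖ < ρ := by simpa [dist_eq_norm] using hx
      calc ‖z‖ = ‖x₀ + (x - x₀) - (x - z)‖ := by congr 1; abel
        _ ≤ ‖x₀‖ + ‖x - x₀‖ + ‖x - z‖ := (norm_sub_le _ _).trans (by gcongr; exact norm_add_le _ _)
        _ ≤ _ := by linarith
    have hzR : ‖z‖ ^ 2 + 0 ≤ R / 2 := by
      have : ‖z‖ ^ 2 ≤ (‖x₀‖ + ρ + R₀) ^ 2 := by gcongr
      linarith
    simp only [radial, Hs, Hf, cutoff_eq_one hRpos hzR]
    push_cast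
    ring
  obtain ⟨b, hb⟩ := cN.continuous.bounded_above_of_compact_support sN
  have i2 : ∀ x, Integrable fun z => f (x - z) * radial Hf 0 z := fun x =>
    (hf.comp_sub_left x).smul_bdd b cN.continuous.aestronglyMeasurable (Eventually.of_forall hb)
  constructor
  · have h1 := ((i1 x₀ (Metric.mem_ball_self hρ)).add (i2 x₀)).comp_sub_left x₀
    refine h1.congr (Eventually.of_forall fun y => ?_)
    have := split x₀ (Metric.mem_ball_self hρ) (x₀ - y)
    rw [sub_sub_cancel] at this
    simp only [Pi.add_apply, sub_sub_cancel]
    exact this.symm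
  · have c2 : ContDiff ℝ 2 fun x => ∫ z, f (x - z) * radial Hf 0 z := by
      have h1 := sN.contDiff_convolution_right (ContinuousLinearMap.mul ℝ ℂ)
        hf.locallyIntegrable cN (μ := volume) (n := 2)
      convert! h1 using 1
      ext x
      rw [convolution_def, ← integral_sub_left_eq_self _ volume x]
      simp
    have hball : Metric.ball x₀ ρ ∈ 𝓝 x₀ := Metric.ball_mem_nhds x₀ hρ
    refine ((c1.contDiffAt hball).add c2.contDiffAt).congr_of_eventuallyEq ?_
    filter_upwards [hball] with x hx
    rw [← integral_add (i1 x hx) (i2 x), ← integral_sub_left_eq_self _ volume x]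
    simp only [sub_sub_cancel]
    exact integral_congr_ae (Eventually.of_forall fun z => split x hx z)

end HelmholtzProfile

/-! ### Potentials of integrable densities; weak and classical solutions. -/

section Potential

variable {d : ℕ} {k : ℝ} {h h1 h2 : ℝ → ℂ}

lemma laplacian_comp_add_right (φ : EuclideanSpace ℝ (Fin d) → ℂ) (y z : EuclideanSpace ℝ (Fin d)) :
    Δ (fun z => φ (z + y)) z = Δ φ (z + y) := by
  simp only [laplacian_eq_sum_fderiv]
  have h1 : fderiv ℝ (fun z => φ (z + y)) = fun z => fderiv ℝ φ (z + y) :=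
    funext fun z => fderiv_comp_add_right y
  rw [h1, fderiv_comp_add_right]

namespace HelmholtzProfile

/-- The fundamental solution truncated to a ball. -/
lemma integrable_truncated (P : HelmholtzProfile d k h h1 h2) (hd : 0 < d) (R : ℝ) :
    Integrable ((Metric.closedBall (0 : EuclideanSpace ℝ (Fin d)) R).indicator (radial h 0)) :=
  (P.integrableOn_radial hd R).integrable_indicator measurableSet_closedBall

/-- Bounded support of f lets the kernel be truncated for x in a fixed ball. The truncated kernel is
integrable on the whole space, so L¹ convolution and Fubini apply. -/
lemma mul_truncated {f : EuclideanSpace ℝ (Fin d) → ℂ} {R₀ : ℝ} (hf0 : ∀ y, R₀ < ‖y‖ → f y = 0)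
    {R : ℝ} {x : EuclideanSpace ℝ (Fin d)} (hx : ‖x‖ ≤ R) (y : EuclideanSpace ℝ (Fin d)) :
    f y * (Metric.closedBall (0 : EuclideanSpace ℝ (Fin d)) (R + R₀)).indicator (radial h 0)
      (x - y) = f y * radial h 0 (x - y) := by
  rcases le_or_gt ‖y‖ R₀ with hy | hy
  · rw [indicator_of_mem]
    rw [mem_closedBall_zero_iff]
    exact (norm_sub_le _ _).trans (add_le_add hx hy)
  · simp [hf0 y hy]

lemma integrable_prod (P : HelmholtzProfile d k h h1 h2) (hd : 0 < d)
    {f : EuclideanSpace ℝ (Fin d) → ℂ} (hf : Integrable f) (R : ℝ) :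
    Integrable (fun p : EuclideanSpace ℝ (Fin d) × EuclideanSpace ℝ (Fin d) =>
      f p.2 * (Metric.closedBall (0 : EuclideanSpace ℝ (Fin d)) R).indicator (radial h 0)
        (p.1 - p.2)) (volume.prod volume) :=
  hf.convolution_integrand (ContinuousLinearMap.mul ℝ ℂ) (P.integrable_truncated hd R)

/-- The truncation depends on a bound for |x|, so the exceptional null sets are collected over balls
of integer radius. -/
lemma ae_integrable_potential (P : HelmholtzProfile d k h h1 h2) (hd : 0 < d)
    {f : EuclideanSpace ℝ (Fin d) → ℂ} (hf : Integrable f) {R₀ : ℝ}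
    (hf0 : ∀ y, R₀ < ‖y‖ → f y = 0) :
    ∀ᵐ x, Integrable fun y => f y * radial h 0 (x - y) := by
  have h1 : ∀ n : ℕ, ∀ᵐ x : EuclideanSpace ℝ (Fin d), ‖x‖ ≤ n →
      Integrable fun y => f y * radial h 0 (x - y) := by
    intro n
    filter_upwards [(P.integrable_prod hd hf (n + R₀)).prod_right_ae] with x hx hxn
    exact hx.congr (Eventually.of_forall fun y => mul_truncated hf0 hxn y)
  filter_upwards [ae_all_iff.mpr h1] with x hx
  obtain ⟨n, hn⟩ := exists_nat_ge ‖x‖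
  exact hx n hn

lemma locallyIntegrable_potential (P : HelmholtzProfile d k h h1 h2) (hd : 0 < d)
    {f : EuclideanSpace ℝ (Fin d) → ℂ} (hf : Integrable f) {R₀ : ℝ}
    (hf0 : ∀ y, R₀ < ‖y‖ → f y = 0) :
    LocallyIntegrable fun x => ∫ y, f y * radial h 0 (x - y) := by
  rw [locallyIntegrable_iff]
  intro K hK
  obtain ⟨R, hR⟩ := hK.isBounded.subset_closedBall 0
  have h1 := (P.integrable_prod hd hf (R + R₀)).integral_prod_left
  refine (IntegrableOn.congr_fun (h1.integrableOn (s := Metric.closedBall 0 R)) ?_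
    measurableSet_closedBall).mono_set hR
  intro x hx
  exact integral_congr_ae (Eventually.of_forall fun y => mul_truncated hf0 (by simpa using hx) y)

/-- The potential of an integrable density solves the Helmholtz equation in the sense of
distributions. -/
theorem helmholtzDistrib_potential (P : HelmholtzProfile d k h h1 h2) (hd : 0 < d)
    {f : EuclideanSpace ℝ (Fin d) → ℂ} (hf : Integrable f) {R₀ : ℝ}
    (hf0 : ∀ y, R₀ < ‖y‖ → f y = 0) :
    HelmholtzDistrib k (fun x => ∫ y, f y * radial h 0 (x - y)) fun x => -f x := by
  refine ⟨P.locallyIntegrable_potential hd hf hf0, hf.neg.locallyIntegrable, fun φ hφ hc => ?_⟩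
  have hφ2 : ContDiff ℝ 2 φ := contDiff_infty.mp hφ 2
  set ψ : EuclideanSpace ℝ (Fin d) → ℂ := fun x => Δ φ x + (k : ℂ) ^ 2 * φ x with hψ
  have cψ : Continuous ψ := continuous_helmholtz hφ2 k
  have sψ : HasCompactSupport ψ := hasCompactSupport_helmholtz hc k
  obtain ⟨R, hR⟩ := sψ.isCompact.isBounded.subset_closedBall 0
  obtain ⟨b, hb⟩ := cψ.bounded_above_of_compact_support sψ
  set g := (Metric.closedBall (0 : EuclideanSpace ℝ (Fin d)) (R + R₀)).indicator (radial h 0)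
    with hg
  have hzero : ∀ x, R < ‖x‖ → ψ x = 0 := fun x hx =>
    image_eq_zero_of_notMem_tsupport fun h => by
      have := hR h
      rw [mem_closedBall_zero_iff] at this
      linarith
  have hI : Integrable (fun p : EuclideanSpace ℝ (Fin d) × EuclideanSpace ℝ (Fin d) =>
      f p.2 * g (p.1 - p.2) * ψ p.1) (volume.prod volume) :=
    (P.integrable_prod hd hf (R + R₀)).mul_bdd (c := b)
      (cψ.comp continuous_fst).aestronglyMeasurable (Eventually.of_forall fun p => hb p.1)
  have e1 : ∀ x, (∫ y, f y * radial h 0 (x - y)) * ψ x = ∫ y, f y * g (x - y) * ψ x := by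
    intro x
    rcases le_or_gt ‖x‖ R with hx | hx
    · rw [← integral_mul_const]
      refine integral_congr_ae (Eventually.of_forall fun y => ?_)
      simp only [hg, mul_truncated hf0 hx y]
    · simp [hzero x hx]
  -- For fixed y, translation reduces the inner integral to the fundamental solution tested on φ(· +
  -- y), whose value at the origin is φ(y).
  have e2 : ∀ y, ∫ x, f y * g (x - y) * ψ x = -f y * φ y := by
    intro y
    have h3 : ∀ x, f y * g (x - y) * ψ x = f y * (radial h 0 (x - y) * ψ x) := by
      intro x
      rcases le_or_gt ‖x‖ R with hx | hx
      · rw [hg, mul_truncated hf0 hx y, mul_assoc]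
      · simp [hzero x hx]
    simp only [h3]
    rw [integral_const_mul, ← integral_add_right_eq_self _ y]
    have h4 := P.integral_radial_mul_helmholtz hd (φ := fun z => φ (z + y))
      (hφ2.comp (contDiff_id.add contDiff_const)) (hc.comp_homeomorph (Homeomorph.addRight y))
    simp only [laplacian_comp_add_right, zero_add] at h4
    simp only [add_sub_cancel_right, hψ]
    rw [h4]
    ring
  calc ∫ x, (∫ y, f y * radial h 0 (x - y)) * ψ x = ∫ x, ∫ y, f y * g (x - y) * ψ x := by
        simp only [e1]
    _ = ∫ y, ∫ x, f y * g (x - y) * ψ x := integral_integral_swap hI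
    _ = ∫ y, -f y * φ y := by simp only [e2]

end HelmholtzProfile

lemma contDiff_ofReal_comp {g : EuclideanSpace ℝ (Fin d) → ℝ} (hg : ContDiff ℝ ∞ g) :
    ContDiff ℝ ∞ fun x => (g x : ℂ) := Complex.ofRealCLM.contDiff.comp hg

lemma hasCompactSupport_ofReal_comp {g : EuclideanSpace ℝ (Fin d) → ℝ}
    (hg : HasCompactSupport g) : HasCompactSupport fun x => (g x : ℂ) :=
  hg.comp_left (g := Complex.ofReal) Complex.ofReal_zero

/-- Both sources pair equally with every test function. Real-valued tests already suffice for the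
fundamental lemma, applied to the complex function f - g. -/
lemma HelmholtzDistrib.ae_eq {u f g : EuclideanSpace ℝ (Fin d) → ℂ}
    (hf : HelmholtzDistrib k u f) (hg : HelmholtzDistrib k u g) : f =ᵐ[volume] g := by
  have h0 := ae_eq_zero_of_integral_contDiff_smul_eq_zero (hf.2.1.sub hg.2.1)
    fun φ hφ hc => by
      have c1 : HasCompactSupport fun x => (φ x : ℂ) := hasCompactSupport_ofReal_comp hc
      have h1 := (hf.2.2 _ (contDiff_ofReal_comp hφ) c1).symm.trans
        (hg.2.2 _ (contDiff_ofReal_comp hφ) c1)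
      have i1 : Integrable fun x => f x * (φ x : ℂ) := by
        have := hf.2.1.integrable_smul_left_of_hasCompactSupport
          (contDiff_ofReal_comp hφ).continuous c1
        simpa [mul_comm] using this
      have i2 : Integrable fun x => g x * (φ x : ℂ) := by
        have := hg.2.1.integrable_smul_left_of_hasCompactSupport
          (contDiff_ofReal_comp hφ).continuous c1
        simpa [mul_comm] using this
      have e : ∀ x, φ x • (f - g) x = f x * (φ x : ℂ) - g x * (φ x : ℂ) := fun x => by
        rw [Complex.real_smul, Pi.sub_apply]; ring
      simp only [e]
      rw [integral_sub i1 i2, h1, sub_self]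
  filter_upwards [h0] with x hx
  exact sub_eq_zero.mp hx

/-- A distributional solution of the Helmholtz equation is a classical one at the points near which
it is `C²` and the source is continuous. -/
theorem HelmholtzDistrib.eq_at {u f : EuclideanSpace ℝ (Fin d) → ℂ} (hu : HelmholtzDistrib k u f)
    {x₀ : EuclideanSpace ℝ (Fin d)} (hu2 : ContDiffAt ℝ 2 u x₀)
    (hf : ∀ᶠ x in 𝓝 x₀, ContinuousAt f x) : Δ u x₀ + (k : ℂ) ^ 2 * u x₀ = f x₀ := by
  obtain ⟨U, hU, hUo, hxU⟩ := eventually_nhds_iff.mp ((hu2.eventually (by simp)).and hf)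
  set w : EuclideanSpace ℝ (Fin d) → ℂ := fun x => Δ u x + (k : ℂ) ^ 2 * u x with hw
  have cw : ContinuousOn w U := fun x hx => ((continuousAt_laplacian (hU x hx).1).add
    (continuousAt_const.mul (hU x hx).1.continuousAt)).continuousWithinAt
  have cf : ContinuousOn f U := fun x hx => (hU x hx).2.continuousWithinAt
  -- For tests supported in U, Green's identity moves the operator back onto u. The weak equation
  -- then says that w - f is orthogonal to all of them, and continuity upgrades equality a.e. to
  -- equality at x₀.
  have h0 := hUo.ae_eq_zero_of_integral_contDiff_smul_eq_zero (μ := volume)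
    (f := fun x => w x - f x)
    ((cw.sub cf).locallyIntegrableOn hUo.measurableSet) fun φ hφ hc hs => by
      have c1 : HasCompactSupport fun x => (φ x : ℂ) := hasCompactSupport_ofReal_comp hc
      have s1 : tsupport (fun x => (φ x : ℂ)) ⊆ U := by
        refine (closure_mono fun x hx => ?_).trans hs
        simpa using hx
      have hφ' := contDiff_ofReal_comp hφ
      have h1 := hu.2.2 _ hφ' c1
      rw [integral_mul_helmholtz k (contDiff_infty.mp hφ' 2) c1
        fun x hx => (hU x (s1 hx)).1] at h1
      have i1 : Integrable fun x => w x * (φ x : ℂ) :=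
        integrable_mul_of_continuousAt hφ'.continuous c1
          fun x hx => cw.continuousAt (hUo.mem_nhds (s1 hx))
      have i2 : Integrable fun x => f x * (φ x : ℂ) :=
        integrable_mul_of_continuousAt hφ'.continuous c1
          fun x hx => cf.continuousAt (hUo.mem_nhds (s1 hx))
      have e : ∀ x, φ x • (w x - f x) = w x * (φ x : ℂ) - f x * (φ x : ℂ) := fun x => by
        rw [Complex.real_smul]; ring
      simp only [e]
      rw [integral_sub i1 i2, h1, sub_self]
  have h2 : w =ᵐ[volume.restrict U] f := by
    rw [Filter.EventuallyEq, ae_restrict_iff' hUo.measurableSet]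
    filter_upwards [h0] with x hx hxU
    exact sub_eq_zero.mp (hx hxU)
  exact Measure.eqOn_open_of_ae_eq h2 hUo cw cf hxU

end Potential

/-! ### The amplitude as a potential, and the dimension-free inversion. -/

section Amplitude

variable {d : ℕ} {k : ℝ}

lemma norm_phase (r₂ r : EuclideanSpace ℝ (Fin d)) : ‖phase k r₂ r‖ = 1 :=
  Complex.norm_exp_I_mul_ofReal _

lemma phase_ne_zero (r₂ r : EuclideanSpace ℝ (Fin d)) : phase k r₂ r ≠ 0 := Complex.exp_ne_zero _

lemma contDiff_phase_inv (r₂ : EuclideanSpace ℝ (Fin d)) :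
    ContDiff ℝ 1 fun r => (phase k r₂ r)⁻¹ := by
  refine ContDiff.inv ?_ (phase_ne_zero r₂)
  have h1 : ContDiff ℝ 1 fun r : EuclideanSpace ℝ (Fin d) => k * ⟪‖r₂‖⁻¹ • r₂, r⟫ :=
    contDiff_const.mul (contDiff_const.inner ℝ contDiff_id)
  exact (contDiff_const.mul (Complex.ofRealCLM.contDiff.comp h1)).cexp

/-- A modulated density which is Hölder continuous near a point satisfies the estimates of the
local regularity theorem. -/
lemma exists_holder_estimates {η p : EuclideanSpace ℝ (Fin d) → ℂ} (hp : ContDiff ℝ 1 p)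
    (hp1 : ∀ x, ‖p x‖ = 1) (c : ℂ) {x₀ : EuclideanSpace ℝ (Fin d)} (hη : HolderNear η x₀) :
    ∃ ρ B M α : ℝ, 0 < ρ ∧ 0 < α ∧ 0 ≤ B ∧ 0 ≤ M ∧
      (∀ x ∈ Metric.ball x₀ ρ, ∀ z, ‖z‖ ≤ ρ → ‖c * p (x - z) * η (x - z)‖ ≤ B) ∧
      (∀ x ∈ Metric.ball x₀ ρ, ∀ z, ‖z‖ ≤ ρ →
        ‖c * p (x - z) * η (x - z) - c * p x * η x‖ ≤ M * ‖z‖ ^ α) := by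
  obtain ⟨s, hs, C, α, hα, hH⟩ := hη
  obtain ⟨K, t, ht, hK⟩ := hp.contDiffAt.exists_lipschitzOnWith (x := x₀)
  obtain ⟨r, hr, hrs⟩ := Metric.mem_nhds_iff.mp (inter_mem hs ht)
  set N : ℝ := ‖η x₀‖ + C * r ^ (α : ℝ)
  have hN0 : 0 ≤ N := by positivity
  have hN : ∀ x ∈ Metric.ball x₀ r, ‖η x‖ ≤ N := by
    intro x hx
    have h1 := hH.dist_le (hrs hx).1 (hrs (Metric.mem_ball_self hr)).1
    rw [dist_eq_norm] at h1
    have h2 : dist x x₀ ^ (α : ℝ) ≤ r ^ (α : ℝ) :=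
      Real.rpow_le_rpow dist_nonneg (le_of_lt hx) α.2
    calc ‖η x‖ = ‖η x₀ + (η x - η x₀)‖ := by congr 1; abel
      _ ≤ ‖η x₀‖ + ‖η x - η x₀‖ := norm_add_le _ _
      _ ≤ N := by simp only [N]; gcongr; exact h1.trans (by gcongr)
  have hmem : ∀ x ∈ Metric.ball x₀ (min (r / 2) 1), ∀ z, ‖z‖ ≤ min (r / 2) 1 →
      x ∈ Metric.ball x₀ r ∧ x - z ∈ Metric.ball x₀ r := by
    intro x hx z hz
    have h1 : dist x x₀ < r / 2 := lt_of_lt_of_le hx (min_le_left _ _)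
    have h2 : ‖z‖ ≤ r / 2 := hz.trans (min_le_left _ _)
    have h3 : dist (x - z) x ≤ r / 2 := by simpa [dist_eq_norm] using h2
    refine ⟨Metric.mem_ball.mpr (by linarith), Metric.mem_ball.mpr ?_⟩
    linarith [dist_triangle (x - z) x x₀]
  -- Radius at most r/2 keeps both x and x - z in the ball where the estimates hold. Radius at most
  -- 1 lets the Hölder bound for η and the Lipschitz bound for p be weakened to the common exponent
  -- min(α, 1).
  refine ⟨min (r / 2) 1, ‖c‖ * N, ‖c‖ * (C + K * N), min α 1, by positivity,
    lt_min (by exact_mod_cast hα) one_pos, by positivity, by positivity, ?_, ?_⟩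
  · intro x hx z hz
    have := hN _ (hmem x hx z hz).2
    rw [norm_mul, norm_mul, hp1, mul_one]
    gcongr
  · intro x hx z hz
    obtain ⟨m1, m2⟩ := hmem x hx z hz
    have hz1 : ‖z‖ ≤ 1 := hz.trans (min_le_right _ _)
    have h1 := hH.dist_le (hrs m2).1 (hrs m1).1
    have h2 := hK.dist_le_mul _ (hrs m2).2 _ (hrs m1).2
    rw [dist_eq_norm, dist_eq_norm, sub_sub_cancel_left, norm_neg] at h1 h2
    have e1 : ‖z‖ ^ (α : ℝ) ≤ ‖z‖ ^ min (α : ℝ) 1 :=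
      Real.rpow_le_rpow_of_exponent_ge_of_imp (norm_nonneg z) hz1 (min_le_left _ _)
        (fun _ h => absurd h (by exact_mod_cast hα.ne'))
    have e2 : ‖z‖ ≤ ‖z‖ ^ min (α : ℝ) 1 := by
      conv_lhs => rw [← Real.rpow_one ‖z‖]
      exact Real.rpow_le_rpow_of_exponent_ge_of_imp (norm_nonneg z) hz1 (min_le_right _ _)
        (fun _ h => absurd h one_ne_zero)
    have e3 := hN x m1
    calc ‖c * p (x - z) * η (x - z) - c * p x * η x‖
        = ‖c * (p (x - z) * (η (x - z) - η x) + (p (x - z) - p x) * η x)‖ := by congr 1; ring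
      _ ≤ ‖c‖ * (‖p (x - z)‖ * ‖η (x - z) - η x‖ + ‖p (x - z) - p x‖ * ‖η x‖) := by
          rw [norm_mul]
          gcongr
          refine (norm_add_le _ _).trans ?_
          rw [norm_mul, norm_mul]
      _ ≤ ‖c‖ * (1 * (C * ‖z‖ ^ min (α : ℝ) 1) + (K * ‖z‖ ^ min (α : ℝ) 1) * N) := by
          rw [hp1]
          gcongr
          · exact h1.trans (by gcongr)
          · exact h2.trans (by gcongr)
      _ = _ := by ring

lemma HolderNear.eventually_continuousAt {η : EuclideanSpace ℝ (Fin d) → ℂ}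
    {x₀ : EuclideanSpace ℝ (Fin d)} (hη : HolderNear η x₀) : ∀ᶠ x in 𝓝 x₀, ContinuousAt η x := by
  obtain ⟨s, hs, C, α, hα, hH⟩ := hη
  filter_upwards [eventually_mem_nhds_iff.mpr hs] with x hx
  exact (hH.continuousOn hα).continuousAt hx

/-- The inverse scattering formula for a Green's function given by a Helmholtz profile. -/
theorem HelmholtzProfile.inversion {h h1 h2 : ℝ → ℂ} (P : HelmholtzProfile d k h h1 h2)
    (hd : 0 < d) {c : ℂ} (hc : c ≠ 0) {Ω : Set (EuclideanSpace ℝ (Fin d))}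
    {η : EuclideanSpace ℝ (Fin d) → ℂ} (r₂ : EuclideanSpace ℝ (Fin d))
    (hΩ : Bornology.IsBounded Ω) (hη : Integrable η) (hs : Function.support η ⊆ Ω)
    {G : EuclideanSpace ℝ (Fin d) → EuclideanSpace ℝ (Fin d) → ℂ}
    (hG : ∀ r r', G r r' = h (‖r - r'‖ ^ 2)) {A : EuclideanSpace ℝ (Fin d) → ℂ}
    (hA : ∀ r₁, A r₁ = c * ∫ r in Ω, amplitudeIntegrand k η (fun r => G r r₁) r₂ r) :
    (∀ᵐ r₁, IntegrableOn (amplitudeIntegrand k η (fun r => G r r₁) r₂) Ω) ∧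
    HelmholtzDistrib k A (fun r₁ => -c * (phase k r₂ r₁)⁻¹ * η r₁) ∧
    (∀ g : EuclideanSpace ℝ (Fin d) → ℂ, HelmholtzDistrib k A g →
      ∀ᵐ r₁, η r₁ = -(phase k r₂ r₁ / c) * g r₁) ∧
    (∀ r₁, HolderNear η r₁ →
      IntegrableOn (amplitudeIntegrand k η (fun r => G r r₁) r₂) Ω ∧
      ContDiffAt ℝ 2 A r₁ ∧
      Δ A r₁ + (k : ℂ) ^ 2 * A r₁ = -c * (phase k r₂ r₁)⁻¹ * η r₁ ∧
      η r₁ = -(phase k r₂ r₁ / c) * (Δ A r₁ + (k : ℂ) ^ 2 * A r₁)) := by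
  set p : EuclideanSpace ℝ (Fin d) → ℂ := fun r => (phase k r₂ r)⁻¹ with hp
  have cp : ContDiff ℝ 1 p := contDiff_phase_inv r₂
  have np : ∀ x, ‖p x‖ = 1 := fun x => by simp [hp, norm_phase]
  -- Absorbing the constant and the phase into the density turns the amplitude into a pure
  -- potential.
  set f : EuclideanSpace ℝ (Fin d) → ℂ := fun r => c * p r * η r with hfdef
  have hf : Integrable f :=
    hη.bdd_mul (c := ‖c‖) (continuous_const.mul cp.continuous).aestronglyMeasurable
      (Eventually.of_forall fun x => by rw [norm_mul, np, mul_one])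
  obtain ⟨R₀, hR₀⟩ := hΩ.subset_closedBall 0
  have hη0 : ∀ y ∉ Ω, η y = 0 := fun y hy => Function.notMem_support.mp fun h => hy (hs h)
  have hf0 : ∀ y, R₀ < ‖y‖ → f y = 0 := fun y hy => by
    have : y ∉ Ω := fun h => by
      have := hR₀ h
      rw [mem_closedBall_zero_iff] at this
      linarith
    simp [hfdef, hη0 y this]
  have hrad : ∀ r₁ r, c * amplitudeIntegrand k η (fun r => G r r₁) r₂ r =
      f r * radial h 0 (r₁ - r) := fun r₁ r => by
    simp only [amplitudeIntegrand, hfdef, hp, hG, radial, add_zero, norm_sub_rev r r₁]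
    ring
  have hA' : A = fun r₁ => ∫ y, f y * radial h 0 (r₁ - y) := by
    ext r₁
    rw [hA, setIntegral_eq_integral_of_forall_compl_eq_zero fun y hy => by
      simp [amplitudeIntegrand, hη0 y hy], ← integral_const_mul]
    simp only [hrad]
  have hint : ∀ r₁, Integrable (fun y => f y * radial h 0 (r₁ - y)) →
      IntegrableOn (amplitudeIntegrand k η (fun r => G r r₁) r₂) Ω := fun r₁ hi => by
    refine ((hi.const_mul c⁻¹).congr (Eventually.of_forall fun r => ?_)).integrableOn
    simp only [← hrad]
    rw [inv_mul_cancel_left₀ hc]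
  have hsol : ∀ (r₁ : EuclideanSpace ℝ (Fin d)) (g : ℂ), g = -c * (phase k r₂ r₁)⁻¹ * η r₁ →
      η r₁ = -(phase k r₂ r₁ / c) * g := fun r₁ g hg => by
    have := phase_ne_zero (k := k) r₂ r₁
    rw [hg]
    field_simp
  have hD : HelmholtzDistrib k A (fun r₁ => -c * (phase k r₂ r₁)⁻¹ * η r₁) := by
    have e : (fun r₁ => -c * (phase k r₂ r₁)⁻¹ * η r₁) = fun x => -f x := by
      ext x; simp only [hfdef, hp]; ring
    rw [hA', e]
    exact P.helmholtzDistrib_potential hd hf hf0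
  refine ⟨?_, hD, ?_, ?_⟩
  · filter_upwards [P.ae_integrable_potential hd hf hf0] with r₁ h using hint r₁ h
  · intro g hg
    filter_upwards [hg.ae_eq hD] with r₁ h using hsol r₁ _ h
  · intro r₁ hr
    obtain ⟨ρ, B, M, α, hρ, hα, hB0, hM0, hB, hM⟩ := exists_holder_estimates cp np c hr
    obtain ⟨i1, c2⟩ := P.contDiffAt_potential hd hf hf0 hρ hα hB0 hM0 hB hM
    rw [← hA'] at c2
    have heq := hD.eq_at c2 (by
      filter_upwards [hr.eventually_continuousAt] with x hx
      exact (continuousAt_const.mul cp.continuous.continuousAt).mul hx)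
    exact ⟨hint r₁ i1, c2, heq, hsol r₁ _ heq⟩

end Amplitude

/-! ### The three-dimensional Green's function. -/

section ThreeDim

/-- The three-dimensional Green's function as a function of the squared distance. -/
def profile3D (k t : ℝ) : ℂ :=
  Complex.exp (Complex.I * ((k * √t : ℝ) : ℂ)) / ((4 * Real.pi * √t : ℝ) : ℂ)

/-- The derivative of `profile3D`. -/
def profile3D' (k t : ℝ) : ℂ :=
  (Complex.I * k * (√t : ℝ) - 1) * Complex.exp (Complex.I * ((k * √t : ℝ) : ℂ)) /
    (8 * Real.pi * (√t : ℝ) ^ 3)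

/-- The second derivative of `profile3D`. -/
def profile3D'' (k t : ℝ) : ℂ :=
  -(6 * profile3D' k t + (k : ℂ) ^ 2 * profile3D k t) / (4 * t)

lemma hasDerivAt_sqrt_ofReal {t : ℝ} (ht : 0 < t) :
    HasDerivAt (fun t : ℝ => ((√t : ℝ) : ℂ)) (1 / (2 * ((√t : ℝ) : ℂ))) t := by
  have := (Real.hasDerivAt_sqrt ht.ne').ofReal_comp
  convert! this using 1
  push_cast
  rfl

lemma hasDerivAt_exp_sqrt (k : ℝ) {t : ℝ} (ht : 0 < t) :
    HasDerivAt (fun t : ℝ => Complex.exp (Complex.I * ((k * √t : ℝ) : ℂ)))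
      (Complex.exp (Complex.I * ((k * √t : ℝ) : ℂ)) *
        (Complex.I * (k * (1 / (2 * ((√t : ℝ) : ℂ)))))) t := by
  refine HasDerivAt.cexp ?_
  simp only [Complex.ofReal_mul]
  exact ((hasDerivAt_sqrt_ofReal ht).const_mul _).const_mul _

lemma helmholtzProfile_profile3D (k : ℝ) :
    HelmholtzProfile 3 k (profile3D k) (profile3D' k) (profile3D'' k) := by
  have hπ : (Real.pi : ℂ) ≠ 0 := by exact_mod_cast Real.pi_ne_zero
  have hs : ∀ {t : ℝ}, 0 < t → ((√t : ℝ) : ℂ) ≠ 0 := fun ht => by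
    exact_mod_cast (Real.sqrt_pos.mpr ht).ne'
  have hsq : ∀ {t : ℝ}, 0 < t → (t : ℂ) = ((√t : ℝ) : ℂ) ^ 2 := fun ht => by
    exact_mod_cast (Real.sq_sqrt (le_of_lt ht)).symm
  refine ⟨fun t ht => ?_, fun t ht => ?_, fun t ht => ?_, ⟨0, ?_⟩, ?_⟩
  · have h0 := hs ht
    have h1 := (hasDerivAt_exp_sqrt k ht).div
      ((hasDerivAt_sqrt_ofReal ht).const_mul (4 * Real.pi : ℂ)) (by simp [hπ, h0])
    have e : profile3D k = fun t : ℝ => Complex.exp (Complex.I * ((k * √t : ℝ) : ℂ)) /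
        (4 * Real.pi * ((√t : ℝ) : ℂ)) := by
      ext t; simp only [profile3D]; push_cast; rfl
    rw [e]
    refine h1.congr_deriv ?_
    rw [profile3D']
    generalize Complex.exp _ = E
    field_simp
    ring
  · have h0 := hs ht
    have hS := hasDerivAt_sqrt_ofReal ht
    have h1 := ((((hS.const_mul (Complex.I * k)).sub_const 1).mul (hasDerivAt_exp_sqrt k ht)).div
      ((hS.pow 3).const_mul (8 * Real.pi : ℂ)) (by simp [hπ, h0]))
    refine h1.congr_deriv ?_
    simp only [Pi.mul_apply, Pi.pow_apply]
    -- With t = (√t)² and the exponential abstracted, the claim is a rational identity in √t modulo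
    -- i² = -1.
    rw [profile3D'', profile3D', profile3D, hsq ht]
    push_cast
    generalize Complex.exp _ = E
    field_simp
    ring_nf
    simp only [Complex.I_sq]
    ring
  -- `profile3D''` is defined by solving the radial equation, so the equation is immediate; the
  -- content lies in the derivative computed just before.
  · have : (t : ℂ) ≠ 0 := by exact_mod_cast ht.ne'
    rw [profile3D'']
    field_simp
    push_cast
    ring
  · have hc : Continuous fun t : ℝ =>
        ((√t : ℝ) : ℂ) * Complex.exp (Complex.I * ((k * √t : ℝ) : ℂ)) / (4 * Real.pi) := by
      fun_prop
    have h1 := (hc.tendsto 0).mono_left (nhdsWithin_le_nhds (s := Ioi 0))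
    simp only [Real.sqrt_zero, Complex.ofReal_zero, zero_mul, zero_div] at h1
    refine h1.congr' ?_
    filter_upwards [self_mem_nhdsWithin] with t ht
    have h0 := hs (t := t) ht
    rw [profile3D]
    push_cast
    field_simp
  · have hc : Continuous fun t : ℝ => (Complex.I * k * (√t : ℝ) - 1) *
        Complex.exp (Complex.I * ((k * √t : ℝ) : ℂ)) / (8 * Real.pi) := by
      fun_prop
    have h1 := (hc.tendsto 0).mono_left (nhdsWithin_le_nhds (s := Ioi 0))
    have hv : volume.real (Metric.ball (0 : EuclideanSpace ℝ (Fin 3)) 1) = Real.pi * 4 / 3 := by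
      rw [Measure.real, EuclideanSpace.volume_ball_fin_three]
      simp only [ENNReal.ofReal_one, one_pow, one_mul]
      exact ENNReal.toReal_ofReal (by positivity)
    -- With ball volume 4π/3, both sides are -1/(8π).
    have e : (Complex.I * k * ((√0 : ℝ) : ℂ) - 1) *
        Complex.exp (Complex.I * ((k * √0 : ℝ) : ℂ)) / (8 * Real.pi) =
        -(1 / (2 * (3 : ℕ) * (volume.real (Metric.ball (0 : EuclideanSpace ℝ (Fin 3)) 1) : ℂ))) := by
      rw [hv]
      simp
      field_simp
      norm_num
    rw [e] at h1
    refine h1.congr' ?_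
    filter_upwards [self_mem_nhdsWithin] with t ht
    have h0 := hs (t := t) ht
    rw [profile3D']
    push_cast
    field_simp

end ThreeDim

/-! ### Entire power series with factorially decaying coefficients. -/

section PowerSeries

/-- The sum of the power series with coefficients `a`. -/
def powerSum (a : ℕ → ℝ) (u : ℝ) : ℝ := ∑' m, a m * u ^ m

/-- The coefficients `a` are `O (1 / m!)`. -/
def FactorialBound (a : ℕ → ℝ) : Prop := ∃ C, ∀ m, |a m| ≤ C / (m.factorial : ℝ)

/-- The coefficients of the derived power series. -/
def derivCoeff (a : ℕ → ℝ) (m : ℕ) : ℝ := (m + 1) * a (m + 1)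

variable {a b : ℕ → ℝ}

namespace FactorialBound

/-- Since (m + 1)/(m + 1)! = 1/m!, the class is closed under differentiation with the same constant.
-/
lemma derivCoeff (ha : FactorialBound a) : FactorialBound (derivCoeff a) := by
  obtain ⟨C, hC⟩ := ha
  refine ⟨C, fun m => ?_⟩
  have h1 : (0 : ℝ) < m + 1 := by positivity
  rw [InverseScattering.derivCoeff, abs_mul, abs_of_pos h1]
  calc (m + 1 : ℝ) * |a (m + 1)| ≤ (m + 1) * (C / ((m + 1).factorial : ℝ)) := by
        gcongr; exact hC _
    _ = C / (m.factorial : ℝ) := by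
        rw [Nat.factorial_succ]; push_cast; field_simp

lemma summable (ha : FactorialBound a) (u : ℝ) : Summable fun m => a m * u ^ m := by
  obtain ⟨C, hC⟩ := ha
  refine Summable.of_norm_bounded ((Real.summable_pow_div_factorial |u|).mul_left C) fun m => ?_
  rw [norm_mul, norm_pow, Real.norm_eq_abs, Real.norm_eq_abs]
  calc |a m| * |u| ^ m ≤ C / (m.factorial : ℝ) * |u| ^ m := by gcongr; exact hC m
    _ = _ := by ring

/-- Termwise differentiation on the ball of radius |u| + 1, where the differentiated series is
dominated by an exponential series. -/
lemma hasDerivAt (ha : FactorialBound a) (u : ℝ) :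
    HasDerivAt (powerSum a) (powerSum (InverseScattering.derivCoeff a) u) u := by
  obtain ⟨C, hC⟩ := id ha
  set R := |u| + 1 with hR
  have hR0 : 0 < R := by positivity
  have hsum : Summable fun n : ℕ => C / (n.factorial : ℝ) * (n * R ^ (n - 1)) := by
    rw [← summable_nat_add_iff 1]
    refine ((Real.summable_pow_div_factorial R).mul_left C).congr fun n => ?_
    rw [Nat.factorial_succ, Nat.add_sub_cancel]
    push_cast
    field_simp
  have key := hasDerivAt_tsum_of_isPreconnected (g := fun n y => a n * y ^ n)
    (g' := fun n y => a n * (n * y ^ (n - 1))) (t := Metric.ball (0 : ℝ) R) (y₀ := 0) (y := u)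
    hsum Metric.isOpen_ball (convex_ball 0 R).isPreconnected
    (fun n y _ => (hasDerivAt_pow n y).const_mul (a n))
    (fun n y hy => by
      have hy' : |y| ≤ R := by
        rw [mem_ball_zero_iff, Real.norm_eq_abs] at hy
        exact hy.le
      rw [norm_mul, norm_mul, norm_pow, Real.norm_eq_abs, Real.norm_eq_abs, Real.norm_eq_abs,
        Nat.abs_cast]
      have := hC n
      exact mul_le_mul this (by gcongr) (by positivity) ((abs_nonneg _).trans this))
    (Metric.mem_ball_self hR0) (ha.summable 0) (by simp [hR])
  refine key.congr_deriv ?_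
  have h0 : Summable fun n : ℕ => a n * (n * u ^ (n - 1)) := by
    rw [← summable_nat_add_iff 1]
    refine (ha.derivCoeff.summable u).congr fun n => ?_
    simp [InverseScattering.derivCoeff]
    ring
  rw [h0.tsum_eq_zero_add, powerSum]
  simp [InverseScattering.derivCoeff]
  refine tsum_congr fun n => ?_
  ring

lemma continuous (ha : FactorialBound a) : Continuous (powerSum a) :=
  continuous_iff_continuousAt.mpr fun u => (ha.hasDerivAt u).continuousAt

/-- The action of the operator `u ∂² + ∂ + 1` on a power series. -/
lemma bessel_operator (ha : FactorialBound a) (u : ℝ) :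
    u * powerSum (InverseScattering.derivCoeff (InverseScattering.derivCoeff a)) u +
      powerSum (InverseScattering.derivCoeff a) u + powerSum a u =
      ∑' m : ℕ, ((m + 1) ^ 2 * a (m + 1) + a m) * u ^ m := by
  have h1 := ha.derivCoeff.summable u
  have h2 := ha.derivCoeff.derivCoeff.summable u
  have h3 : Summable fun m : ℕ => m * InverseScattering.derivCoeff a m * u ^ m := by
    rw [← summable_nat_add_iff 1]
    refine (h2.mul_left u).congr fun m => ?_
    simp only [InverseScattering.derivCoeff]
    push_cast
    ring
  have e : u * powerSum (InverseScattering.derivCoeff (InverseScattering.derivCoeff a)) u =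
      ∑' m : ℕ, m * InverseScattering.derivCoeff a m * u ^ m := by
    rw [h3.tsum_eq_zero_add, powerSum, ← tsum_mul_left]
    simp only [InverseScattering.derivCoeff]
    push_cast
    rw [zero_mul, zero_mul, zero_add]
    refine tsum_congr fun m => ?_
    ring
  rw [e, powerSum, powerSum, ← h3.tsum_add h1, ← (h3.add h1).tsum_add (ha.summable u)]
  refine tsum_congr fun m => ?_
  simp only [InverseScattering.derivCoeff]
  ring

end FactorialBound

lemma powerSum_zero (a : ℕ → ℝ) : powerSum a 0 = a 0 := by
  rw [powerSum, tsum_eq_single 0 fun m hm => by simp [hm]]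
  simp

end PowerSeries

/-! ### The two-dimensional Green's function and the Bessel equation. -/

section TwoDim

/-- The coefficients of `J₀` in the variable `(x / 2)²`. -/
def coeffJ (m : ℕ) : ℝ := (-1) ^ m / (m.factorial : ℝ) ^ 2

/-- The coefficients of the harmonic part of `Y₀` in the variable `(x / 2)²`. -/
def coeffY (m : ℕ) : ℝ := (-1) ^ m * ((harmonic m : ℚ) : ℝ) / (m.factorial : ℝ) ^ 2

lemma one_le_factorial (m : ℕ) : (1 : ℝ) ≤ m.factorial := by exact_mod_cast m.factorial_pos

lemma factorialBound_coeffJ : FactorialBound coeffJ := by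
  refine ⟨1, fun m => ?_⟩
  have h1 := one_le_factorial m
  rw [coeffJ, abs_div, abs_pow, abs_neg, abs_one, one_pow, abs_of_nonneg (by positivity)]
  gcongr
  nlinarith

/-- A crude bound is enough: one of the two factorials in the denominator of `coeffY` is spent on
the harmonic number. -/
lemma harmonic_nonneg_le_factorial (m : ℕ) :
    0 ≤ ((harmonic m : ℚ) : ℝ) ∧ ((harmonic m : ℚ) : ℝ) ≤ m.factorial := by
  induction m with
  | zero => simp
  | succ n ih =>
    rw [harmonic_succ, Nat.factorial_succ]
    push_cast
    have h1 := one_le_factorial n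
    refine ⟨add_nonneg ih.1 (by positivity), ?_⟩
    rcases Nat.eq_zero_or_pos n with rfl | hn
    · simp
    · have h2 : ((n : ℝ) + 1)⁻¹ ≤ 1 := inv_le_one_of_one_le₀ (by linarith [n.cast_nonneg (α := ℝ)])
      have h3 : (1 : ℝ) ≤ n := by exact_mod_cast hn
      nlinarith

lemma factorialBound_coeffY : FactorialBound coeffY := by
  refine ⟨1, fun m => ?_⟩
  have h1 := one_le_factorial m
  obtain ⟨h2, h3⟩ := harmonic_nonneg_le_factorial m
  rw [coeffY, abs_div, abs_mul, abs_pow, abs_neg, abs_one, one_pow, one_mul,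
    abs_of_nonneg h2, abs_of_nonneg (a := (m.factorial : ℝ) ^ 2) (by positivity),
    div_le_div_iff₀ (by positivity) (by positivity), one_mul, pow_two]
  gcongr

lemma coeffJ_succ (m : ℕ) : ((m : ℝ) + 1) ^ 2 * coeffJ (m + 1) = -coeffJ m := by
  rw [coeffJ, coeffJ, Nat.factorial_succ]
  push_cast
  field_simp
  ring

/-- The parts proportional to the harmonic number cancel as for J₀. The increment 1/(m + 1) remains
and yields the coefficients of the derivative of the J₀ series. -/
lemma coeffY_succ (m : ℕ) :
    ((m : ℝ) + 1) ^ 2 * coeffY (m + 1) + coeffY m = derivCoeff coeffJ m := by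
  rw [derivCoeff, coeffY, coeffY, coeffJ, harmonic_succ, Nat.factorial_succ]
  push_cast
  field_simp
  ring

lemma bessel_operator_coeffJ (u : ℝ) :
    u * powerSum (derivCoeff (derivCoeff coeffJ)) u + powerSum (derivCoeff coeffJ) u +
      powerSum coeffJ u = 0 := by
  rw [factorialBound_coeffJ.bessel_operator]
  simp [coeffJ_succ]

lemma bessel_operator_coeffY (u : ℝ) :
    u * powerSum (derivCoeff (derivCoeff coeffY)) u + powerSum (derivCoeff coeffY) u +
      powerSum coeffY u = powerSum (derivCoeff coeffJ) u := by
  rw [factorialBound_coeffY.bessel_operator]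
  simp only [coeffY_succ]
  rfl

/-- `π / 2 * Y₀` in the variable `u = (x / 2)²`. -/
def reducedY (u : ℝ) : ℝ :=
  (Real.log u / 2 + Real.eulerMascheroniConstant) * powerSum coeffJ u - powerSum coeffY u

/-- The derivative of `reducedY`. -/
def reducedY' (u : ℝ) : ℝ :=
  powerSum coeffJ u / (2 * u) +
    (Real.log u / 2 + Real.eulerMascheroniConstant) * powerSum (derivCoeff coeffJ) u -
    powerSum (derivCoeff coeffY) u

/-- The second derivative of `reducedY`. -/
def reducedY'' (u : ℝ) : ℝ :=
  -powerSum coeffJ u / (2 * u ^ 2) + powerSum (derivCoeff coeffJ) u / u +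
    (Real.log u / 2 + Real.eulerMascheroniConstant) *
      powerSum (derivCoeff (derivCoeff coeffJ)) u -
    powerSum (derivCoeff (derivCoeff coeffY)) u

variable {u : ℝ}

lemma hasDerivAt_reducedY (hu : 0 < u) : HasDerivAt reducedY (reducedY' u) u := by
  have hl := ((Real.hasDerivAt_log hu.ne').div_const 2).add_const Real.eulerMascheroniConstant
  refine ((hl.mul (factorialBound_coeffJ.hasDerivAt u)).sub
    (factorialBound_coeffY.hasDerivAt u)).congr_deriv ?_
  rw [reducedY']
  field_simp

lemma hasDerivAt_reducedY' (hu : 0 < u) : HasDerivAt reducedY' (reducedY'' u) u := by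
  have hl := ((Real.hasDerivAt_log hu.ne').div_const 2).add_const Real.eulerMascheroniConstant
  have hi := (hasDerivAt_id u).const_mul (2 : ℝ)
  refine ((((factorialBound_coeffJ.hasDerivAt u).div hi (by simpa using hu.ne')).add
    (hl.mul (factorialBound_coeffJ.derivCoeff.hasDerivAt u))).sub
    (factorialBound_coeffY.derivCoeff.hasDerivAt u)).congr_deriv ?_
  rw [reducedY'']
  simp only [id]
  field_simp
  ring

/-- Applied to the logarithmic term, the operator leaves, besides log times the J₀ equation, exactly
the derivative of the J₀ series; the harmonic series cancels it. -/
lemma bessel_operator_reducedY (hu : 0 < u) :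
    u * reducedY'' u + reducedY' u + reducedY u = 0 := by
  have e1 := bessel_operator_coeffJ u
  have e2 := bessel_operator_coeffY u
  rw [reducedY'', reducedY', reducedY]
  have e3 : u * (-powerSum coeffJ u / (2 * u ^ 2) + powerSum (derivCoeff coeffJ) u / u) +
      powerSum coeffJ u / (2 * u) = powerSum (derivCoeff coeffJ) u := by
    field_simp
    ring
  linear_combination e3 + (Real.log u / 2 + Real.eulerMascheroniConstant) * e1 - e2

/-- The two-dimensional Green's function in the variable `u = (k |r| / 2)²`. -/
def reducedGreen2D (J Y : ℝ) : ℂ := Complex.I / 4 * (J : ℂ) - 1 / (2 * Real.pi) * (Y : ℂ)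

lemma HasDerivAt.reducedGreen2D {f g : ℝ → ℝ} {f' g' : ℝ} (hf : HasDerivAt f f' u)
    (hg : HasDerivAt g g' u) :
    HasDerivAt (fun u => reducedGreen2D (f u) (g u)) (reducedGreen2D f' g') u :=
  (hf.ofReal_comp.const_mul _).sub (hg.ofReal_comp.const_mul _)

/-- The two-dimensional Green's function as a function of the squared distance. -/
def profile2D (k t : ℝ) : ℂ := Complex.I / 4 * hankelH0 (k * √t)

/-- The derivative of `profile2D`. -/
def profile2D' (k t : ℝ) : ℂ :=
  (k ^ 2 / 4 : ℝ) * reducedGreen2D (powerSum (derivCoeff coeffJ) (k ^ 2 / 4 * t))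
    (reducedY' (k ^ 2 / 4 * t))

/-- The second derivative of `profile2D`. -/
def profile2D'' (k t : ℝ) : ℂ :=
  (k ^ 2 / 4 : ℝ) ^ 2 *
    reducedGreen2D (powerSum (derivCoeff (derivCoeff coeffJ)) (k ^ 2 / 4 * t))
      (reducedY'' (k ^ 2 / 4 * t))

lemma besselJ0_eq (x : ℝ) : besselJ0 x = powerSum coeffJ ((x / 2) ^ 2) := by
  rw [besselJ0, powerSum]
  refine tsum_congr fun m => ?_
  rw [coeffJ, pow_mul]
  ring

lemma besselY0_eq (x : ℝ) : besselY0 x = 2 / Real.pi * reducedY ((x / 2) ^ 2) := by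
  have e : ∑' m : ℕ, (-1) ^ m * ((harmonic m : ℚ) : ℝ) * (x / 2) ^ (2 * m) /
      (m.factorial : ℝ) ^ 2 = powerSum coeffY ((x / 2) ^ 2) := by
    rw [powerSum]
    refine tsum_congr fun m => ?_
    rw [coeffY, pow_mul]
    ring
  rw [besselY0, e, besselJ0_eq, reducedY, Real.log_pow]
  push_cast
  rw [mul_div_cancel_left₀ _ two_ne_zero]

/-- The coefficient -1/(2π) is (i/4) · i · (2/π). -/
lemma profile2D_eq {k t : ℝ} (ht : 0 < t) :
    profile2D k t = reducedGreen2D (powerSum coeffJ (k ^ 2 / 4 * t)) (reducedY (k ^ 2 / 4 * t)) := by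
  have hs : 0 < √t := Real.sqrt_pos.mpr ht
  have e : (k * √t / 2) ^ 2 = k ^ 2 / 4 * t := by
    rw [div_pow, mul_pow, Real.sq_sqrt ht.le]; ring
  have hπ : (Real.pi : ℂ) ≠ 0 := by exact_mod_cast Real.pi_ne_zero
  rw [profile2D, hankelH0, besselJ0_eq, besselY0_eq, e, reducedGreen2D]
  push_cast
  field_simp
  ring_nf
  simp only [Complex.I_sq]
  ring

lemma tendsto_mul_log_nhdsGT : Tendsto (fun u : ℝ => u * Real.log u) (𝓝[>] 0) (𝓝 0) := by
  have := tendsto_log_mul_rpow_nhdsGT_zero one_pos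
  simpa [mul_comm] using this

lemma tendsto_sqrt_mul_log_nhdsGT :
    Tendsto (fun u : ℝ => √u * Real.log u) (𝓝[>] 0) (𝓝 0) := by
  have := tendsto_log_mul_rpow_nhdsGT_zero (r := 1 / 2) (by norm_num)
  simpa [mul_comm, Real.sqrt_eq_rpow] using this

lemma tendsto_mul_reducedY : Tendsto (fun u => √u * reducedY u) (𝓝[>] 0) (𝓝 0) := by
  have cJ := (factorialBound_coeffJ.continuous.tendsto 0).mono_left
    (nhdsWithin_le_nhds (s := Ioi 0))
  have cY := (factorialBound_coeffY.continuous.tendsto 0).mono_left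
    (nhdsWithin_le_nhds (s := Ioi 0))
  have cs : Tendsto (fun u : ℝ => √u) (𝓝[>] 0) (𝓝 0) := by
    simpa using (Real.continuous_sqrt.tendsto 0).mono_left (nhdsWithin_le_nhds (s := Ioi 0))
  have h1 := (((tendsto_sqrt_mul_log_nhdsGT.div_const 2).add
    (cs.mul_const Real.eulerMascheroniConstant)).mul cJ).sub (cs.mul cY)
  simp only [zero_div, zero_mul, add_zero, sub_zero] at h1
  refine h1.congr fun u => ?_
  rw [reducedY]
  ring

/-- The 1/(2u) from differentiating the logarithm, times J₀(0) = 1, gives the limit; every term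
still containing a logarithm is killed by u. -/
lemma tendsto_mul_reducedY' : Tendsto (fun u => u * reducedY' u) (𝓝[>] 0) (𝓝 (1 / 2)) := by
  have cJ := (factorialBound_coeffJ.continuous.tendsto 0).mono_left
    (nhdsWithin_le_nhds (s := Ioi 0))
  have cJ1 := (factorialBound_coeffJ.derivCoeff.continuous.tendsto 0).mono_left
    (nhdsWithin_le_nhds (s := Ioi 0))
  have cY1 := (factorialBound_coeffY.derivCoeff.continuous.tendsto 0).mono_left
    (nhdsWithin_le_nhds (s := Ioi 0))
  have cs : Tendsto (fun u : ℝ => u) (𝓝[>] 0) (𝓝 0) := tendsto_id.mono_left nhdsWithin_le_nhds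
  have h1 := ((cJ.div_const 2).add (((tendsto_mul_log_nhdsGT.div_const 2).add
    (cs.mul_const Real.eulerMascheroniConstant)).mul cJ1)).sub (cs.mul cY1)
  simp only [zero_div, zero_mul, add_zero, sub_zero, powerSum_zero] at h1
  rw [show coeffJ 0 = 1 by simp [coeffJ]] at h1
  refine h1.congr' ?_
  filter_upwards [self_mem_nhdsWithin] with u hu
  have hu : u ≠ 0 := ne_of_gt hu
  rw [reducedY']
  field_simp

lemma tendsto_const_mul_nhdsGT {κ : ℝ} (hκ : 0 < κ) :
    Tendsto (fun t : ℝ => κ * t) (𝓝[>] 0) (𝓝[>] 0) := by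
  refine tendsto_nhdsWithin_iff.mpr ⟨?_, ?_⟩
  · have : Continuous fun t : ℝ => κ * t := by fun_prop
    simpa using (this.tendsto 0).mono_left nhdsWithin_le_nhds
  · filter_upwards [self_mem_nhdsWithin] with t ht
    exact mul_pos hκ ht

lemma helmholtzProfile_profile2D {k : ℝ} (hk : 0 < k) :
    HelmholtzProfile 2 k (profile2D k) (profile2D' k) (profile2D'' k) := by
  set κ : ℝ := k ^ 2 / 4 with hκ
  have κpos : 0 < κ := by positivity
  have hlin : ∀ t, HasDerivAt (fun t : ℝ => κ * t) κ t := fun t => by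
    simpa using (hasDerivAt_id t).const_mul κ
  refine ⟨fun t ht => ?_, fun t ht => ?_, fun t ht => ?_, ⟨0, ?_⟩, ?_⟩
  · have hu : 0 < κ * t := mul_pos κpos ht
    have h1 := (HasDerivAt.reducedGreen2D (factorialBound_coeffJ.hasDerivAt (κ * t))
      (hasDerivAt_reducedY hu)).scomp t (hlin t)
    refine (h1.congr_of_eventuallyEq ?_).congr_deriv ?_
    · filter_upwards [Ioi_mem_nhds ht] with s hs using profile2D_eq hs
    · rw [Complex.real_smul]; rfl
  · have hu : 0 < κ * t := mul_pos κpos ht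
    have h1 := ((HasDerivAt.reducedGreen2D (factorialBound_coeffJ.derivCoeff.hasDerivAt (κ * t))
      (hasDerivAt_reducedY' hu)).scomp t (hlin t)).const_mul (κ : ℂ)
    refine h1.congr_deriv ?_
    rw [Complex.real_smul, profile2D'', ← mul_assoc, ← pow_two]
  · have hu : 0 < κ * t := mul_pos κpos ht
    have e1 : ((κ * t * powerSum (derivCoeff (derivCoeff coeffJ)) (κ * t) +
      powerSum (derivCoeff coeffJ) (κ * t) + powerSum coeffJ (κ * t) : ℝ) : ℂ) = 0 := by
      rw [bessel_operator_coeffJ, Complex.ofReal_zero]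
    have e2 : ((κ * t * reducedY'' (κ * t) + reducedY' (κ * t) + reducedY (κ * t) : ℝ) : ℂ) = 0 := by
      rw [bessel_operator_reducedY hu, Complex.ofReal_zero]
    -- With u = κt, the radial equation in dimension two is 4κ times the reduced Bessel equation in
    -- u.
    have e3 : (k : ℂ) ^ 2 = 4 * (κ : ℂ) := by rw [hκ]; push_cast; ring
    rw [profile2D_eq ht, profile2D', profile2D'', ← hκ, e3]
    simp only [reducedGreen2D]
    push_cast at e1 e2 ⊢
    linear_combination (4 * (κ : ℂ) * (Complex.I / 4)) * e1 -
      (4 * (κ : ℂ) * (1 / (2 * Real.pi))) * e2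
  · have hJ : Tendsto (fun u : ℝ => √u * powerSum coeffJ u) (𝓝[>] 0) (𝓝 0) := by
      have : Continuous fun u : ℝ => √u * powerSum coeffJ u :=
        Real.continuous_sqrt.mul factorialBound_coeffJ.continuous
      simpa using (this.tendsto 0).mono_left (nhdsWithin_le_nhds (s := Ioi 0))
    have h1 := (((Complex.continuous_ofReal.tendsto _).comp
      (hJ.comp (tendsto_const_mul_nhdsGT κpos))).const_mul (Complex.I / 4)).sub
      (((Complex.continuous_ofReal.tendsto _).comp
        (tendsto_mul_reducedY.comp (tendsto_const_mul_nhdsGT κpos))).const_mul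
        (1 / (2 * Real.pi) : ℂ))
    -- The limits are known with weight √(κt); dividing by √κ restores the weight √t.
    have h2 := h1.const_mul (((√κ : ℝ) : ℂ)⁻¹)
    simp only [Complex.ofReal_zero, mul_zero, sub_zero] at h2
    refine h2.congr' ?_
    filter_upwards [self_mem_nhdsWithin] with t ht
    have hs : ((√κ : ℝ) : ℂ) ≠ 0 := by exact_mod_cast (Real.sqrt_pos.mpr κpos).ne'
    rw [profile2D_eq ht, reducedGreen2D, ← hκ]
    simp only [Function.comp_apply, Real.sqrt_mul κpos.le]
    push_cast
    field_simp
  · have hJ : Tendsto (fun u : ℝ => u * powerSum (derivCoeff coeffJ) u) (𝓝[>] 0) (𝓝 0) := by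
      have : Continuous fun u : ℝ => u * powerSum (derivCoeff coeffJ) u :=
        continuous_id.mul factorialBound_coeffJ.derivCoeff.continuous
      simpa using (this.tendsto 0).mono_left (nhdsWithin_le_nhds (s := Ioi 0))
    have h1 := (((Complex.continuous_ofReal.tendsto _).comp
      (hJ.comp (tendsto_const_mul_nhdsGT κpos))).const_mul (Complex.I / 4)).sub
      (((Complex.continuous_ofReal.tendsto _).comp
        (tendsto_mul_reducedY'.comp (tendsto_const_mul_nhdsGT κpos))).const_mul
        (1 / (2 * Real.pi) : ℂ))
    have hv : volume.real (Metric.ball (0 : EuclideanSpace ℝ (Fin 2)) 1) = Real.pi := by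
      rw [Measure.real, EuclideanSpace.volume_ball_fin_two]
      simp [Real.pi_pos.le]
    -- With the unit disc of area π, both sides are -1/(4π). The J₀ part is regular at the origin
    -- and contributes nothing.
    have e : Complex.I / 4 * ((0 : ℝ) : ℂ) - 1 / (2 * Real.pi) * ((1 / 2 : ℝ) : ℂ) =
        -(1 / (2 * (2 : ℕ) * (volume.real (Metric.ball (0 : EuclideanSpace ℝ (Fin 2)) 1) : ℂ))) := by
      rw [hv]
      push_cast
      ring
    rw [e] at h1
    refine h1.congr' ?_
    filter_upwards [self_mem_nhdsWithin] with t ht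
    rw [profile2D', reducedGreen2D, ← hκ, Real.sq_sqrt (le_of_lt ht)]
    simp only [Function.comp_apply]
    push_cast
    ring

end TwoDim

end InverseScattering

end

theorem mainTheorem1 (k : ℝ) (hk : 0 < k) :
    -- two dimensions
    (∀ (Ω : Set (EuclideanSpace ℝ (Fin 2))) (η : EuclideanSpace ℝ (Fin 2) → ℂ)
        (r₂ : EuclideanSpace ℝ (Fin 2)),
      MeasurableSet Ω → Bornology.IsBounded Ω → Integrable η → Function.support η ⊆ Ω → r₂ ≠ 0 →
      -- the amplitude is well defined and satisfies the equation in the sense of distributions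
      (∀ᵐ r₁, IntegrableOn (InverseScattering.amplitudeIntegrand k η
          (fun r => InverseScattering.green2D k r r₁) r₂) Ω) ∧
      InverseScattering.HelmholtzDistrib k
        (fun r₁ => InverseScattering.amplitude2D k Ω η r₁ r₂)
        (fun r₁ => -((k ^ (3 / 2 : ℝ) : ℝ) : ℂ) *
          (InverseScattering.phase k r₂ r₁)⁻¹ * η r₁) ∧
      -- the inversion formula, almost everywhere
      (∀ g : EuclideanSpace ℝ (Fin 2) → ℂ,
        InverseScattering.HelmholtzDistrib k
          (fun r₁ => InverseScattering.amplitude2D k Ω η r₁ r₂) g →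
        ∀ᵐ r₁, η r₁ =
          -(InverseScattering.phase k r₂ r₁ / ((k ^ (3 / 2 : ℝ) : ℝ) : ℂ)) * g r₁) ∧
      -- the equation and the inversion formula, pointwise
      (∀ r₁ : EuclideanSpace ℝ (Fin 2), InverseScattering.HolderNear η r₁ →
        IntegrableOn (InverseScattering.amplitudeIntegrand k η
          (fun r => InverseScattering.green2D k r r₁) r₂) Ω ∧
        ContDiffAt ℝ 2 (fun r => InverseScattering.amplitude2D k Ω η r r₂) r₁ ∧
        Δ (fun r => InverseScattering.amplitude2D k Ω η r r₂) r₁ +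
            (k : ℂ) ^ 2 * InverseScattering.amplitude2D k Ω η r₁ r₂ =
          -((k ^ (3 / 2 : ℝ) : ℝ) : ℂ) * (InverseScattering.phase k r₂ r₁)⁻¹ * η r₁ ∧
        η r₁ = -(InverseScattering.phase k r₂ r₁ / ((k ^ (3 / 2 : ℝ) : ℝ) : ℂ)) *
          (Δ (fun r => InverseScattering.amplitude2D k Ω η r r₂) r₁ +
            (k : ℂ) ^ 2 * InverseScattering.amplitude2D k Ω η r₁ r₂))) ∧
    -- three dimensions
    (∀ (Ω : Set (EuclideanSpace ℝ (Fin 3))) (η : EuclideanSpace ℝ (Fin 3) → ℂ)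
        (r₂ : EuclideanSpace ℝ (Fin 3)),
      MeasurableSet Ω → Bornology.IsBounded Ω → Integrable η → Function.support η ⊆ Ω → r₂ ≠ 0 →
      (∀ᵐ r₁, IntegrableOn (InverseScattering.amplitudeIntegrand k η
          (fun r => InverseScattering.green3D k r r₁) r₂) Ω) ∧
      InverseScattering.HelmholtzDistrib k
        (fun r₁ => InverseScattering.amplitude3D k Ω η r₁ r₂)
        (fun r₁ => -((k ^ 2 : ℝ) : ℂ) * (InverseScattering.phase k r₂ r₁)⁻¹ * η r₁) ∧
      (∀ g : EuclideanSpace ℝ (Fin 3) → ℂ,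
        InverseScattering.HelmholtzDistrib k
          (fun r₁ => InverseScattering.amplitude3D k Ω η r₁ r₂) g →
        ∀ᵐ r₁, η r₁ =
          -(InverseScattering.phase k r₂ r₁ / ((k ^ 2 : ℝ) : ℂ)) * g r₁) ∧
      (∀ r₁ : EuclideanSpace ℝ (Fin 3), InverseScattering.HolderNear η r₁ →
        IntegrableOn (InverseScattering.amplitudeIntegrand k η
          (fun r => InverseScattering.green3D k r r₁) r₂) Ω ∧
        ContDiffAt ℝ 2 (fun r => InverseScattering.amplitude3D k Ω η r r₂) r₁ ∧
        Δ (fun r => InverseScattering.amplitude3D k Ω η r r₂) r₁ +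
            (k : ℂ) ^ 2 * InverseScattering.amplitude3D k Ω η r₁ r₂ =
          -((k ^ 2 : ℝ) : ℂ) * (InverseScattering.phase k r₂ r₁)⁻¹ * η r₁ ∧
        η r₁ = -(InverseScattering.phase k r₂ r₁ / ((k ^ 2 : ℝ) : ℂ)) *
          (Δ (fun r => InverseScattering.amplitude3D k Ω η r r₂) r₁ +
            (k : ℂ) ^ 2 * InverseScattering.amplitude3D k Ω η r₁ r₂))) := by
  have hc2 : ((k ^ (3 / 2 : ℝ) : ℝ) : ℂ) ≠ 0 := by
    exact_mod_cast (Real.rpow_pos_of_pos hk _).ne'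
  have hc3 : ((k ^ 2 : ℝ) : ℂ) ≠ 0 := by exact_mod_cast (pow_pos hk 2).ne'
  constructor
  · intro Ω η r₂ _ hΩ hη hs _
    exact (InverseScattering.helmholtzProfile_profile2D hk).inversion two_pos hc2 r₂ hΩ hη hs
      (fun r r' => by
        rw [InverseScattering.green2D, InverseScattering.profile2D, Real.sqrt_sq (norm_nonneg _)])
      (fun _ => rfl)
  · intro Ω η r₂ _ hΩ hη hs _
    exact (InverseScattering.helmholtzProfile_profile3D k).inversion three_pos hc3 r₂ hΩ hη hs
      (fun r r' => by
        rw [InverseScattering.green3D, InverseScattering.profile3D, Real.sqrt_sq (norm_nonneg _)])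
      (fun _ => rfl)
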